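/- Let $G=(V,m,a)$ be a weighted directed graph: $V$ is countable, $m:V\to(0,\infty)$, $a:V\times V\to[0,\infty)$, and for every $v$ only finitely many $w$ satisfy $a(v,w)>0$ or $a(w,v)>0$. The edge set is $E=\{(i,j): a(i,j)>0\}$, where $(i,j)$ is an edge from $j$ to $i$. Put $d^-(v)=\sum_w a(v,w)$ and $d^+(v)=\sum_w a(w,v)$, and assume that there is $C_0>0$ with $d^\pm(v)\le C_0\,m(v)$ for all $v$. On the complex Hilbert space $\ell^2(G)=\ell^2(V,m)$, with $\langle f,g\rangle=\sum_v\overline{f(v)}g(v)m(v)$, the in-degree Laplacian is the bounded operator $[L^-f](x)=\frac1{m(x)}\big(d^-(x)f(x)-\sum_y a(x,y)f(y)\big)$. Let $\tilde E\subseteq E$ be a finite set of edges (the union of the edge sets of the clusters). Let $L^-_{\tilde E}$ and $L^-_{E\setminus\tilde E}$ be the in-degree Laplacians of the graphs obtained from $G$ by keeping only the weights on $\tilde E$, respectively $E\setminus\tilde E$, and let $L^-_\beta=L^-_{E\setminus\tilde E}+\beta L^-_{\tilde E}$. A vertex $j$ sees $i$ if there is a directed path (possibly of length $0$) from $i$ to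 $j$ in $(V,\tilde E)$. A reach of $(V,\tilde E)$ is a maximal set among the sets $\{j: j\text{ sees }i\}$, $i\in V$; $\mathfrak R$ denotes the set of reaches. For $R\in\mathfrak R$, the cabal $B(R)$ is the set of vertices of $R$ from which all of $R$ can be reached, the common part $C(R)$ consists of the vertices of $R$ that see a vertex of another reach, and $H(R)=R\setminus C(R)$. For each $R\in\mathfrak R$ there is exactly one $\vec\gamma_R:V\to\mathbb R$ with $L^-_{\tilde E}\vec\gamma_R=0$, $\vec\gamma_R=1$ on $H(R)$, $\vec\gamma_R\in(0,1)$ on $C(R)$ and $\vec\gamma_R=0$ off $R$; and there is exactly one $\overleftarrow\gamma_R:V\to\mathbb R$ with $\langle\overleftarrow\gamma_R,L^-_{\tilde E}f\rangle=0$ for all $f$, $\overleftarrow\gamma_R>0$ on $B(R)$, $\overleftarrow\gamma_R=0$ off $B(R)$, and $\sum_j\overleftarrow\gamma_R(j)m(j)=1$. Let $P=\sum_{S\in\mathfrak R}\vec\gamma_S\langle\overleftarrow\gamma_S,\cdot\rangle$. The reduced graph $\underline G^-$ has node set $\mathfrak R$, masses $\underline m(R)=\langle\chi_R,P\chi_R\rangle$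 and weights $$\underline a(R,S)=\underline m(R)\sum_{r\in R,\,s\in S}\overleftarrow\gamma_R(r)\,a(r,s)\,\vec\gamma_S(s).$$ It is again a weighted directed graph as above (positive masses, locally finite, degrees bounded relative to the masses); let $\underline L^-$ be its in-degree Laplacian, a bounded operator on $\ell^2(\underline G^-)$. The formulas $[J^-_\downarrow f](R)=\langle\overleftarrow\gamma_R,f\rangle$ and $J^-_\uparrow\underline f=\sum_{R}\underline f(R)\vec\gamma_R$ define bounded operators $J^-_\downarrow:\ell^2(G)\to\ell^2(\underline G^-)$ and $J^-_\uparrow:\ell^2(\underline G^-)\to\ell^2(G)$. Theorem. For every $z$ in the resolvent set of $\underline L^-$ there are constants $C,\beta_0>0$ such that for all $\beta\ge\beta_0$ the point $z$ lies in the resolvent set of $L^-_\beta$ and $$\big\|(L^-_\beta-z)^{-1}-J^-_\uparrow(\underline L^--z)^{-1}J^-_\downarrow\big\|\le\frac C\beta .$$ -/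

import Mathlib

open MeasureTheory

/-- A weighted directed graph on `V`: positive masses, nonnegative weights, locally finite.
The weight `weight v w` belongs to the edge `(v, w)`, which originates at `w` and
terminates at `v`. -/
structure WeightedDigraph (V : Type*) where
  mass : V → ℝ
  weight : V → V → ℝ
  mass_pos : ∀ v, 0 < mass v
  weight_nonneg : ∀ v w, 0 ≤ weight v w
  finite_in : ∀ v, {w | 0 < weight v w}.Finite
  finite_out : ∀ v, {w | 0 < weight w v}.Finite

/-- The inner product `⟨f, g⟩ = ∑ x, conj (f x) * g x * m x`. -/
noncomputable def weightedPairing {V 𝕜 : Type*} [RCLike 𝕜] (m : V → ℝ) (f g : V → 𝕜) : 𝕜 :=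
  ∑' x, (starRingEnd 𝕜) (f x) * g x * (m x : 𝕜)

/-- The measure on the discrete space `V` that gives the point `v` the mass `m v`. -/
noncomputable def massMeasure {V : Type*} (m : V → ℝ) : @Measure V ⊤ :=
  (@Measure.count V ⊤).withDensity (fun v => ENNReal.ofReal (m v))

/-- The complex Hilbert space `ℓ²(V, m)`. For positive `m` only the empty set is null, so that
an element is the same thing as a function `V → ℂ`. -/
abbrev WeightedEll2 {V : Type*} (m : V → ℝ) : Type _ :=
  @Lp V ℂ ⊤ _ 2 (massMeasure m)

/-- The resolvent `(L - z)⁻¹` (used only for `z` in the resolvent set of `L`). -/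
noncomputable def resolventOp {H : Type*} [NormedAddCommGroup H] [NormedSpace ℂ H]
    (L : H →L[ℂ] H) (z : ℂ) : H →L[ℂ] H :=
  Ring.inverse (L - z • (1 : H →L[ℂ] H))

/-! ### Reaches of a set of edges -/

/-- There is a directed path (possibly of length zero) from `i` to `j` along edges in `F`;
in other words, `j` sees `i`. -/
def HasPath {V : Type*} (F : Set (V × V)) (i j : V) : Prop :=
  Relation.ReflTransGen (fun u v => (v, u) ∈ F) i j

/-- All vertices that can be reached from `i`. -/
def reachableSet {V : Type*} (F : Set (V × V)) (i : V) : Set V :=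
  {j | HasPath F i j}

/-- A reach is a maximal reachable set. -/
def IsReach {V : Type*} (F : Set (V × V)) (R : Set V) : Prop :=
  Maximal (fun S => ∃ i, S = reachableSet F i) R

/-- The type of reaches of `(V, F)`. -/
abbrev Reach {V : Type*} (F : Set (V × V)) : Type _ := {R : Set V // IsReach F R}

/-- The vertices of `R` from which all of `R` can be reached. -/
def cabal {V : Type*} {F : Set (V × V)} (R : Reach F) : Set V :=
  {i | i ∈ R.1 ∧ R.1 ⊆ reachableSet F i}

/-- The vertices of `R` that see no vertex of any other reach. -/
def exclusivePart {V : Type*} {F : Set (V × V)} (R : Reach F) : Set V :=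
  {j | j ∈ R.1 ∧ ∀ S : Reach F, S ≠ R → ∀ k ∈ S.1, ¬ HasPath F k j}

/-- The vertices of `R` that also see a vertex of some other reach. -/
def commonPart {V : Type*} {F : Set (V × V)} (R : Reach F) : Set V :=
  {j | j ∈ R.1 ∧ ∃ S : Reach F, S ≠ R ∧ ∃ k ∈ S.1, HasPath F k j}

namespace WeightedDigraph

variable {V : Type*}

def edgeSet (G : WeightedDigraph V) : Set (V × V) := {e | 0 < G.weight e.1 e.2}

noncomputable def inDegree (G : WeightedDigraph V) (v : V) : ℝ := ∑' w, G.weight v w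

noncomputable def outDegree (G : WeightedDigraph V) (v : V) : ℝ := ∑' w, G.weight w v

/-- In- and out-degrees are uniformly bounded relative to the masses. -/
def DegreeBounded (G : WeightedDigraph V) : Prop :=
  ∃ C : ℝ, 0 < C ∧ ∀ v, G.inDegree v ≤ C * G.mass v ∧ G.outDegree v ≤ C * G.mass v

open Classical in
/-- The graph with the same vertices and masses, keeping only the edges that lie in `F`. -/
noncomputable def restrict (G : WeightedDigraph V) (F : Set (V × V)) : WeightedDigraph V where
  mass := G.mass
  weight v w := if (v, w) ∈ F then G.weight v w else 0
  mass_pos := G.mass_pos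
  weight_nonneg v w := by
    split_ifs
    · exact G.weight_nonneg v w
    · exact le_rfl
  finite_in v := (G.finite_in v).subset fun w hw => by
    simp only [Set.mem_ofPred_eq] at hw ⊢
    split_ifs at hw with h
    · exact hw
    · exact absurd hw (lt_irrefl _)
  finite_out v := (G.finite_out v).subset fun w hw => by
    simp only [Set.mem_ofPred_eq] at hw ⊢
    split_ifs at hw with h
    · exact hw
    · exact absurd hw (lt_irrefl _)

/-- The action of the in-degree Laplacian on functions. -/
noncomputable def inLaplacian {𝕜 : Type*} [RCLike 𝕜] (G : WeightedDigraph V) (f : V → 𝕜) :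
    V → 𝕜 :=
  fun x => (G.mass x : 𝕜)⁻¹ *
    ((G.inDegree x : 𝕜) * f x - ∑' y, (G.weight x y : 𝕜) * f y)

/-- The bounded operator `L` on `ℓ²(V, m)` is the in-degree Laplacian of the graph `G`
(whose mass function is `m`). -/
def IsInLaplacian {m : V → ℝ} (G : WeightedDigraph V)
    (L : WeightedEll2 m →L[ℂ] WeightedEll2 m) : Prop :=
  G.mass = m ∧ ∀ (f : WeightedEll2 m) (x : V), L f x = G.inLaplacian (fun y => f y) x

/-- The vector `γ` in the right kernel of the in-degree Laplacian of `(V, F)` that belongs to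
the reach `R`. -/
def IsRightKernelVector (G : WeightedDigraph V) {F : Set (V × V)} (R : Reach F)
    (γ : V → ℝ) : Prop :=
  (∀ x, (G.restrict F).inLaplacian γ x = 0) ∧
  (∀ j ∈ exclusivePart R, γ j = 1) ∧
  (∀ j ∈ commonPart R, 0 < γ j ∧ γ j < 1) ∧
  (∀ j ∉ R.1, γ j = 0)

/-- The vector `γ` whose functional `⟨γ, ·⟩` is in the left kernel of the in-degree Laplacian of
`(V, F)` and belongs to the reach `R`, normalized by `∑ j, ⟨γ, e_j⟩ = ∑ j, γ j * m j = 1`. -/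
def IsLeftKernelVector (G : WeightedDigraph V) {F : Set (V × V)} (R : Reach F)
    (γ : V → ℝ) : Prop :=
  (∀ f : V → ℝ, weightedPairing G.mass γ ((G.restrict F).inLaplacian f) = 0) ∧
  (∀ j ∈ cabal R, 0 < γ j) ∧
  (∀ j ∉ cabal R, γ j = 0) ∧
  ∑' j, γ j * G.mass j = 1

/-- The right kernel vector of the reach `R`. -/
noncomputable def rightVec (G : WeightedDigraph V) {F : Set (V × V)} (R : Reach F) : V → ℝ :=
  Classical.epsilon (G.IsRightKernelVector R)

/-- The left kernel vector of the reach `R`. -/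
noncomputable def leftVec (G : WeightedDigraph V) {F : Set (V × V)} (R : Reach F) : V → ℝ :=
  Classical.epsilon (G.IsLeftKernelVector R)

/-- The action of the projection `P = ∑ S, rightVec S ⟨leftVec S, ·⟩` onto the kernel of the
in-degree Laplacian of `(V, F)`. -/
noncomputable def kernelProj (G : WeightedDigraph V) (F : Set (V × V)) (f : V → ℝ) : V → ℝ :=
  fun v => ∑' S : Reach F, G.rightVec S v * weightedPairing G.mass (G.leftVec S) f

/-- The reduced mass `⟨χ_R, P χ_R⟩` of the reach `R`. -/
noncomputable def reducedMass (G : WeightedDigraph V) (F : Set (V × V)) (R : Reach F) : ℝ :=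
  weightedPairing G.mass (R.1.indicator 1) (G.kernelProj F (R.1.indicator 1))

/-- The reduced edge weight. -/
noncomputable def reducedWeight (G : WeightedDigraph V) (F : Set (V × V)) (R S : Reach F) : ℝ :=
  G.reducedMass F R *
    ∑' (r : R.1) (s : S.1), G.leftVec R r * G.weight r s * G.rightVec S s

/-- `Gr` is the reduced graph: its nodes are the reaches of `(V, F)`. -/
def IsReducedGraph (G : WeightedDigraph V) (F : Set (V × V))
    (Gr : WeightedDigraph (Reach F)) : Prop :=
  (∀ R, Gr.mass R = G.reducedMass F R) ∧ (∀ R S, Gr.weight R S = G.reducedWeight F R S)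

/-- `J` is the projection operator `(J f) R = ⟨leftVec R, f⟩`. -/
def IsProjectionOp (G : WeightedDigraph V) {F : Set (V × V)} {mr : Reach F → ℝ}
    (J : WeightedEll2 G.mass →L[ℂ] WeightedEll2 mr) : Prop :=
  ∀ (f : WeightedEll2 G.mass) (R : Reach F),
    J f R = weightedPairing G.mass (fun v => (G.leftVec R v : ℂ)) (fun v => f v)

/-- `J` is the interpolation operator `J f = ∑ R, f R • rightVec R`. -/
def IsInterpolationOp (G : WeightedDigraph V) {F : Set (V × V)} {mr : Reach F → ℝ}
    (J : WeightedEll2 mr →L[ℂ] WeightedEll2 G.mass) : Prop :=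
  ∀ (f : WeightedEll2 mr) (v : V), J f v = ∑' R : Reach F, f R * (G.rightVec R v : ℂ)

end WeightedDigraph

/-! Write `L_β - z = D + β B` with `B` the Laplacian of the cluster edges `F`. For large `β` only
`ker B` survives. On finite clusters, 0 is a semisimple eigenvalue of `B`: `P = Jup ∘ Jdown`
projects onto `ker B` along the range of `B`. Hence `B` has a reduced inverse `T` with `BT = TB = 1
- P`, and `Jdown ∘ D ∘ Jup` is the reduced Laplacian minus `z`. With `R = Jup (L_red - z)⁻¹ Jdown`,
the operator `R + β⁻¹ (1 - R D) T` is a left inverse of `D + β B` up to `O(1/β)`, and a mirror image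
is a right inverse. A Neumann series does the rest (`inverse_add_smul_sub_le`). No self-adjointness
is needed.

The existence of `T` is a finite-dimensional matter although `V` may be infinite: `B + P` is the
identity up to functions supported on the finitely many endpoints of `F`, so injectivity gives
bijectivity.

What remains is the structure of the two kernels. Cabals are closed under predecessors, and every
vertex is reached from a cabal, so cabals act as the boundary in a minimum principle. Harmonic
functions are constant on each cabal and determined by these constants; solving the Dirichlet
problem gives the right kernel vectors, which sum to 1. A left kernel vector is the stationary
distribution of an irreducible chain on a cabal, found by a Perron-Frobenius argument. Boundedness
of all operators follows from Schur's test. -/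

/-! ### Functions in `ℓ²(V, m)` and Schur's test -/

section Ell2

variable {V : Type*} {m : V → ℝ}

theorem lintegral_massMeasure (m : V → ℝ) (f : V → ENNReal) :
    @lintegral V ⊤ (massMeasure m) f = ∑' x, ENNReal.ofReal (m x) * f x := by
  let _ : MeasurableSpace V := ⊤
  have hm : ∀ {β : Type} [MeasurableSpace β] (g : V → β), Measurable g := fun g _ _ => trivial
  unfold massMeasure
  rw [lintegral_withDensity_eq_lintegral_mul _ (hm _) (hm _), lintegral_count]
  rfl

/-- Points have positive mass, so only the empty set is null. This turns almost-everywhere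
identities in `Lp` into pointwise ones. -/
theorem ae_massMeasure_iff (hm : ∀ v, 0 < m v) (p : V → Prop) :
    (∀ᵐ x ∂(massMeasure m), p x) ↔ ∀ x, p x := by
  let _ : MeasurableSpace V := ⊤
  refine ⟨fun h x => ?_, fun h => Filter.Eventually.of_forall h⟩
  by_contra hx
  have h0 : massMeasure m {x} = 0 :=
    measure_mono_null (by simpa using hx) (ae_iff.1 h)
  rw [massMeasure, withDensity_apply _ (MeasurableSet.singleton x), lintegral_singleton,
    Measure.count_singleton] at h0
  simp [ENNReal.ofReal_eq_zero, not_le.2 (hm x)] at h0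

/-- The squared `ℓ²`-norm as an extended nonnegative number. -/
noncomputable def energy (m : V → ℝ) (f : V → ℂ) : ENNReal :=
  ∑' x, ENNReal.ofReal (m x) * ENNReal.ofReal (‖f x‖ ^ 2)

theorem eLpNorm_massMeasure_sq (m : V → ℝ) (f : V → ℂ) :
    (@eLpNorm V ℂ _ ⊤ f 2 (massMeasure m)) ^ 2 = energy m f := by
  let _ : MeasurableSpace V := ⊤
  have h := eLpNorm_nnreal_pow_eq_lintegral (μ := massMeasure m) (f := f) (p := 2) two_ne_zero
  norm_num at h
  rw [h, lintegral_massMeasure, energy]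
  congr 1; ext x; congr 1
  rw [ENNReal.ofReal_pow (norm_nonneg _), ofReal_norm]

theorem memLp_massMeasure (f : V → ℂ) (hf : energy m f ≠ ⊤) :
    @MemLp V ℂ ⊤ _ _ f 2 (massMeasure m) := by
  let _ : MeasurableSpace V := ⊤
  have hmeas : Measurable f := fun _ _ => trivial
  refine ⟨hmeas.aestronglyMeasurable, ?_⟩
  rw [← eLpNorm_massMeasure_sq] at hf
  exact lt_top_iff_ne_top.2 fun h => hf (by rw [h]; rfl)

namespace WeightedEll2

theorem energy_eq (f : WeightedEll2 m) : energy m (fun x => f x) = ENNReal.ofReal (‖f‖ ^ 2) := by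
  let _ : MeasurableSpace V := ⊤
  rw [← eLpNorm_massMeasure_sq, ENNReal.ofReal_pow (norm_nonneg _), Lp.norm_def,
    ENNReal.ofReal_toReal (Lp.eLpNorm_ne_top f)]

theorem ext {f g : WeightedEll2 m} (h : ∀ x, f x = g x) : f = g := by
  let _ : MeasurableSpace V := ⊤
  exact Lp.ext (Filter.Eventually.of_forall h)

theorem add_apply (hm : ∀ v, 0 < m v) (f g : WeightedEll2 m) (x : V) :
    (f + g) x = f x + g x := by
  let _ : MeasurableSpace V := ⊤
  exact (ae_massMeasure_iff hm _).1 (Lp.coeFn_add f g) x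

theorem sub_apply (hm : ∀ v, 0 < m v) (f g : WeightedEll2 m) (x : V) :
    (f - g) x = f x - g x := by
  let _ : MeasurableSpace V := ⊤
  exact (ae_massMeasure_iff hm _).1 (Lp.coeFn_sub f g) x

theorem smul_apply (hm : ∀ v, 0 < m v) (c : ℂ) (f : WeightedEll2 m) (x : V) :
    (c • f) x = c * f x := by
  let _ : MeasurableSpace V := ⊤
  exact (ae_massMeasure_iff hm _).1 (Lp.coeFn_smul c f) x

theorem zero_apply (hm : ∀ v, 0 < m v) (x : V) : (0 : WeightedEll2 m) x = 0 := by
  let _ : MeasurableSpace V := ⊤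
  exact (ae_massMeasure_iff hm _).1 (Lp.coeFn_zero ℂ 2 (massMeasure m)) x

theorem exists_of_energy (hm : ∀ v, 0 < m v) (f : V → ℂ) (hf : energy m f ≠ ⊤) :
    ∃ g : WeightedEll2 m, ∀ x, g x = f x := by
  let _ : MeasurableSpace V := ⊤
  exact ⟨(memLp_massMeasure f hf).toLp f,
    (ae_massMeasure_iff hm _).1 (memLp_massMeasure f hf).coeFn_toLp⟩

variable {V' : Type*} {m' : V' → ℝ}

/-- Cauchy-Schwarz in each row with weights `K x y`, then Tonelli and the column bound. Working in
`ENNReal` avoids summability questions for `f`. -/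
theorem energy_schur_le (hm' : ∀ v, 0 < m' v) {K : V' → V → ℝ} (hK : ∀ x y, 0 ≤ K x y)
    (hrf : ∀ x, (Function.support (K x)).Finite)
    (hcf : ∀ y, (Function.support fun x => K x y).Finite) {c₁ c₂ : ℝ} (hc₁ : 0 ≤ c₁)
    (hc₂ : 0 ≤ c₂)
    (hrow : ∀ x, ∑' y, K x y ≤ c₁) (hcol : ∀ y, ∑' x, m' x * K x y ≤ c₂ * m y) (f : V → ℂ) :
    energy m' (fun x => ∑' y, (K x y : ℂ) * f y) ≤ ENNReal.ofReal (c₁ * c₂) * energy m f := by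
  have hpt : ∀ x, ENNReal.ofReal (‖∑' y, (K x y : ℂ) * f y‖ ^ 2) ≤
      ENNReal.ofReal c₁ * ∑' y, ENNReal.ofReal (K x y) * ENNReal.ofReal (‖f y‖ ^ 2) := by
    intro x
    set s := (hrf x).toFinset with hs
    have hz : ∀ y ∉ s, K x y = 0 := fun y hy => by simpa [hs] using hy
    rw [tsum_eq_sum (s := s) (fun y hy => by simp [hz y hy]),
      tsum_eq_sum (s := s) (fun y hy => by simp [hz y hy])]
    have hr : ∑ y ∈ s, K x y ≤ c₁ := by
      rw [← tsum_eq_sum (f := K x) (L := .unconditional V) (fun y hy => hz y hy)]; exact hrow x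
    simp_rw [← ENNReal.ofReal_mul (hK x _)]
    rw [← ENNReal.ofReal_sum_of_nonneg (fun y _ => mul_nonneg (hK x y) (sq_nonneg _)),
      ← ENNReal.ofReal_mul hc₁]
    refine ENNReal.ofReal_le_ofReal ?_
    calc ‖∑ y ∈ s, (K x y : ℂ) * f y‖ ^ 2 ≤ (∑ y ∈ s, K x y * ‖f y‖) ^ 2 := by
          gcongr
          refine (norm_sum_le _ _).trans (le_of_eq (Finset.sum_congr rfl fun y _ => ?_))
          rw [norm_mul, Complex.norm_real, Real.norm_of_nonneg (hK x y)]
      _ ≤ (∑ y ∈ s, K x y) * ∑ y ∈ s, K x y * ‖f y‖ ^ 2 :=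
          Finset.sum_sq_le_sum_mul_sum_of_sq_le_mul s (fun y _ => hK x y)
            (fun y _ => mul_nonneg (hK x y) (sq_nonneg _)) (fun y _ => le_of_eq (by ring))
      _ ≤ _ := by
          gcongr
          exact Finset.sum_nonneg fun y _ => mul_nonneg (hK x y) (sq_nonneg _)
  have hcol' : ∀ y, ∑' x, ENNReal.ofReal (m' x) * ENNReal.ofReal (K x y) ≤
      ENNReal.ofReal c₂ * ENNReal.ofReal (m y) := by
    intro y
    simp_rw [← ENNReal.ofReal_mul (hm' _).le]
    rw [← ENNReal.ofReal_mul hc₂, ← ENNReal.ofReal_tsum_of_nonneg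
      (fun x => mul_nonneg (hm' x).le (hK x y))
      (summable_of_hasFiniteSupport ((hcf y).subset fun x hx => right_ne_zero_of_mul hx))]
    exact ENNReal.ofReal_le_ofReal (hcol y)
  unfold energy
  calc _ ≤ ∑' x, ∑' y, ENNReal.ofReal c₁ * (ENNReal.ofReal (‖f y‖ ^ 2) *
          (ENNReal.ofReal (m' x) * ENNReal.ofReal (K x y))) := by
        refine ENNReal.tsum_le_tsum fun x => ?_
        refine (mul_le_mul_right (hpt x) _).trans (le_of_eq ?_)
        rw [← ENNReal.tsum_mul_left, ← ENNReal.tsum_mul_left]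
        refine tsum_congr fun y => ?_; ring
    _ = ENNReal.ofReal c₁ * ∑' y, ENNReal.ofReal (‖f y‖ ^ 2) *
          ∑' x, ENNReal.ofReal (m' x) * ENNReal.ofReal (K x y) := by
        rw [ENNReal.tsum_comm]
        simp_rw [ENNReal.tsum_mul_left]
    _ ≤ ENNReal.ofReal c₁ * ∑' y, ENNReal.ofReal (‖f y‖ ^ 2) *
          (ENNReal.ofReal c₂ * ENNReal.ofReal (m y)) := by
        gcongr with y
        exact hcol' y
    _ = _ := by
        simp_rw [← ENNReal.tsum_mul_left]
        refine tsum_congr fun y => ?_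
        rw [ENNReal.ofReal_mul hc₁]
        ring

/-- Schur's test: a nonnegative kernel with finitely supported rows and columns and with bounded
row and column sums defines a bounded operator. -/
theorem exists_schur (hm : ∀ v, 0 < m v) (hm' : ∀ v, 0 < m' v) {K : V' → V → ℝ}
    (hK : ∀ x y, 0 ≤ K x y) (hrf : ∀ x, (Function.support (K x)).Finite)
    (hcf : ∀ y, (Function.support fun x => K x y).Finite) {c₁ c₂ : ℝ} (hc₁ : 0 ≤ c₁)
    (hc₂ : 0 ≤ c₂)
    (hrow : ∀ x, ∑' y, K x y ≤ c₁) (hcol : ∀ y, ∑' x, m' x * K x y ≤ c₂ * m y) :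
    ∃ T : WeightedEll2 m →L[ℂ] WeightedEll2 m', ∀ f x, T f x = ∑' y, (K x y : ℂ) * f y := by
  have hE : ∀ f : WeightedEll2 m, energy m' (fun x => ∑' y, (K x y : ℂ) * f y) ≤
      ENNReal.ofReal (c₁ * c₂ * ‖f‖ ^ 2) := fun f => by
    rw [ENNReal.ofReal_mul (mul_nonneg hc₁ hc₂), ← energy_eq]
    exact energy_schur_le hm' hK hrf hcf hc₁ hc₂ hrow hcol _
  have hsum : ∀ (f : V → ℂ) x, Summable fun y => (K x y : ℂ) * f y := fun f x =>
    summable_of_hasFiniteSupport ((hrf x).subset fun y hy => by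
      have := left_ne_zero_of_mul hy
      exact_mod_cast this)
  choose T hT using fun f : WeightedEll2 m =>
    exists_of_energy hm' _ (ne_top_of_le_ne_top ENNReal.ofReal_ne_top (hE f))
  let T' : WeightedEll2 m →ₗ[ℂ] WeightedEll2 m' :=
    { toFun := T
      map_add' := fun f g => ext fun x => by
        rw [add_apply hm', hT, hT, hT, ← (hsum _ x).tsum_add (hsum _ x)]
        congr 1; ext y; rw [add_apply hm]; ring
      map_smul' := fun c f => ext fun x => by
        rw [RingHom.id_apply, smul_apply hm', hT, hT, ← tsum_mul_left]
        congr 1; ext y; rw [smul_apply hm]; ring }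
  refine ⟨T'.mkContinuous (Real.sqrt (c₁ * c₂)) fun f => ?_, fun f x => hT f x⟩
  have h1 : ‖T f‖ ^ 2 ≤ c₁ * c₂ * ‖f‖ ^ 2 := by
    have h2 : energy m' (fun x => T f x) ≤ ENNReal.ofReal (c₁ * c₂ * ‖f‖ ^ 2) := by
      rw [show (fun x => T f x) = fun x => ∑' y, (K x y : ℂ) * f y from funext (hT f)]
      exact hE f
    rw [energy_eq] at h2
    exact (ENNReal.ofReal_le_ofReal_iff (by positivity)).1 h2
  have h3 : T' f = T f := rfl
  rw [h3]
  refine abs_le_of_sq_le_sq' ?_ (by positivity) |>.2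
  rw [mul_pow, Real.sq_sqrt (mul_nonneg hc₁ hc₂)]
  exact h1

end WeightedEll2
end Ell2

/-! ### Strong coupling limit in an abstract algebra -/

section Perturbation

/-- Approximate left and right inverses with error `O(1/β)` make `D + β B` invertible; comparing the
true inverse with the left one gives the rate. `T` is the reduced inverse of `B`, and `R` inverts
the compression of `D` by `P`. -/
theorem inverse_add_smul_sub_le {A : Type*} [NormedRing A] [NormedAlgebra ℂ A] [CompleteSpace A]
    {D B P T R : A} (hBT : B * T = 1 - P) (hTB : T * B = 1 - P) (hBP : B * R = 0)
    (hPB : R * B = 0) (hDP : P * D * R = P) (hPD : R * D * P = P) :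
    ∃ C β₀ : ℝ, 0 < C ∧ 0 < β₀ ∧ ∀ β : ℝ, β₀ ≤ β →
      IsUnit (D + (β : ℂ) • B) ∧ ‖Ring.inverse (D + (β : ℂ) • B) - R‖ ≤ C / β := by
  -- The corrections are chosen to cancel the terms of order zero: `Y * B = (1 - R * D) * (1 - P)`,
  -- which equals `1 - R * D` because `R * D * P = P`. `Y'` is the mirror image.
  set Y := T - R * D * T with hY
  set Y' := T - T * D * R with hY'
  -- `β₀` makes `β ≥ 1` and both error terms smaller than `1/2`. The factor `2 * (‖R‖ + ‖Y‖)` is a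
  -- bound for the inverse, and `+ 1` only ensures positivity.
  refine ⟨‖Y‖ + ‖Y * D‖ * (2 * (‖R‖ + ‖Y‖)) + 1, 1 + 2 * ‖Y * D‖ + 2 * ‖D * Y'‖,
    by positivity, by positivity, fun β hβ => ?_⟩
  have hn1 := norm_nonneg (Y * D)
  have hn2 := norm_nonneg (D * Y')
  have hβ1 : 1 ≤ β := by linarith
  have hβ0 : 0 < β := by linarith
  have hβc : (β : ℂ) ≠ 0 := by exact_mod_cast hβ0.ne'
  have hnorm : ‖(β : ℂ)⁻¹‖ = β⁻¹ := by
    rw [norm_inv, Complex.norm_real, Real.norm_of_nonneg hβ0.le]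
  set X := D + (β : ℂ) • B with hX
  have hl : (R + (β : ℂ)⁻¹ • Y) * X = 1 + (β : ℂ)⁻¹ • (Y * D) := by
    have h1 : Y * B = 1 - P - R * D * (1 - P) := by
      rw [hY, sub_mul, mul_assoc (R * D), hTB]
    rw [hX, mul_add, mul_smul_comm, add_mul, add_mul, hPB, smul_mul_assoc, smul_mul_assoc, h1,
      zero_add, smul_smul, mul_inv_cancel₀ hβc, one_smul, mul_sub, mul_one, hPD]
    abel
  have hr : X * (R + (β : ℂ)⁻¹ • Y') = 1 + (β : ℂ)⁻¹ • (D * Y') := by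
    have h1 : B * Y' = 1 - P - (1 - P) * D * R := by
      rw [hY', mul_sub, ← mul_assoc, ← mul_assoc, hBT]
    rw [hX, add_mul, smul_mul_assoc, mul_add, mul_add, hBP, mul_smul_comm, mul_smul_comm, h1,
      zero_add, smul_smul, mul_inv_cancel₀ hβc, one_smul, sub_mul, sub_mul, one_mul, hDP]
    abel
  have hsmall : ∀ Z : A, 2 * ‖Z‖ < β → IsUnit (1 + (β : ℂ)⁻¹ • Z) := by
    intro Z hZ
    have : ‖-((β : ℂ)⁻¹ • Z)‖ < 1 := by
      rw [norm_neg, norm_smul, hnorm, inv_mul_lt_iff₀ hβ0]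
      linarith [norm_nonneg Z]
    simpa [sub_neg_eq_add] using isUnit_one_sub_of_norm_lt_one this
  have hunit : IsUnit X := by
    obtain ⟨u, hu⟩ := hsmall (Y * D) (by linarith)
    obtain ⟨w, hw⟩ := hsmall (D * Y') (by linarith)
    rw [← hu] at hl
    rw [← hw] at hr
    have e1 : (↑u⁻¹ * (R + (β : ℂ)⁻¹ • Y)) * X = 1 := by rw [mul_assoc, hl, Units.inv_mul]
    have e2 : X * ((R + (β : ℂ)⁻¹ • Y') * ↑w⁻¹) = 1 := by rw [← mul_assoc, hr, Units.mul_inv]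
    have e3 := left_inv_eq_right_inv e1 e2
    exact ⟨⟨X, _, e2, e3 ▸ e1⟩, rfl⟩
  refine ⟨hunit, ?_⟩
  set I := Ring.inverse X with hI
  have hkey : I + (β : ℂ)⁻¹ • (Y * D * I) = R + (β : ℂ)⁻¹ • Y := by
    have := congrArg (· * I) hl
    simp only [mul_assoc, hI, Ring.mul_inverse_cancel _ hunit, mul_one, add_mul, one_mul,
      smul_mul_assoc] at this
    rw [this, hI, mul_assoc]
  have hb : ‖(β : ℂ)⁻¹ • (Y * D * I)‖ ≤ β⁻¹ * (‖Y * D‖ * ‖I‖) := by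
    rw [norm_smul, hnorm]
    gcongr
    exact norm_mul_le _ _
  have hinv1 : β⁻¹ ≤ 1 := inv_le_one_of_one_le₀ hβ1
  have hIle : ‖I‖ ≤ 2 * (‖R‖ + ‖Y‖) := by
    have h1 : I = R + (β : ℂ)⁻¹ • Y - (β : ℂ)⁻¹ • (Y * D * I) := by rw [← hkey]; abel
    have h2 : ‖I‖ ≤ ‖R‖ + β⁻¹ * ‖Y‖ + β⁻¹ * (‖Y * D‖ * ‖I‖) := by
      calc ‖I‖ ≤ ‖R + (β : ℂ)⁻¹ • Y‖ + ‖(β : ℂ)⁻¹ • (Y * D * I)‖ := by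
            conv_lhs => rw [h1]
            exact norm_sub_le _ _
        _ ≤ _ := by
            gcongr
            refine (norm_add_le _ _).trans ?_
            rw [norm_smul, hnorm]
    have h3 : β⁻¹ * ‖Y‖ ≤ ‖Y‖ := mul_le_of_le_one_left (norm_nonneg _) hinv1
    -- Half of `‖I‖` is absorbed into the left-hand side, which gives a bound uniform in `β`.
    have h4 : β⁻¹ * (‖Y * D‖ * ‖I‖) ≤ 1 / 2 * ‖I‖ := by
      rw [← mul_assoc]
      gcongr
      rw [inv_mul_le_iff₀ hβ0]; linarith
    linarith
  have h1 : I - R = (β : ℂ)⁻¹ • Y - (β : ℂ)⁻¹ • (Y * D * I) := by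
    rw [sub_eq_sub_iff_add_eq_add, hkey]; abel
  calc ‖I - R‖ ≤ β⁻¹ * ‖Y‖ + β⁻¹ * (‖Y * D‖ * ‖I‖) := by
        rw [h1]
        refine (norm_sub_le _ _).trans ?_
        gcongr
        rw [norm_smul, hnorm]
    _ ≤ β⁻¹ * ‖Y‖ + β⁻¹ * (‖Y * D‖ * (2 * (‖R‖ + ‖Y‖))) := by gcongr
    _ ≤ _ := by
        rw [div_eq_inv_mul, ← mul_add]
        exact mul_le_mul_of_nonneg_left (by linarith) (inv_nonneg.2 hβ0.le)

/-- `T` preserves the finite-dimensional `S` and is onto there, so the defect `g - T g`, which lies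
in `S`, can be corrected inside `S`. -/
theorem surjective_of_injective_of_range_sub_le {K E : Type*} [Field K] [AddCommGroup E]
    [Module K E] (T : E →ₗ[K] E) (S : Submodule K E) [FiniteDimensional K S]
    (hS : ∀ f, f - T f ∈ S) (hT : Function.Injective T) : Function.Surjective T := by
  have hmaps : ∀ f ∈ S, T f ∈ S := fun f hf => by
    simpa using S.sub_mem hf (hS f)
  have hsurj : Function.Surjective (T.restrict hmaps) :=
    LinearMap.surjective_of_injective fun a b hab => Subtype.ext (hT (congrArg Subtype.val hab))
  intro g
  obtain ⟨f, hf⟩ := hsurj ⟨g - T g, hS g⟩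
  refine ⟨f + g, ?_⟩
  have : T f = g - T g := congrArg Subtype.val hf
  rw [map_add, this, sub_add_cancel]

/-- Strong coupling limit of resolvents: if `B` is, up to an operator with finite-dimensional
range, the complementary projection of `Ju ∘ Jd`, and `Ju ∘ Jd` projects onto the kernel of `B`
along its range, then the resolvents of `A + β B` converge. -/
theorem resolventOp_add_smul_sub_le {H H' : Type*} [NormedAddCommGroup H] [NormedSpace ℂ H]
    [CompleteSpace H] [NormedAddCommGroup H'] [NormedSpace ℂ H']
    (A B : H →L[ℂ] H) (Jd : H →L[ℂ] H') (Ju : H' →L[ℂ] H)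
    (hJ : ∀ g, Jd (Ju g) = g) (hBJ : ∀ g, B (Ju g) = 0) (hJB : ∀ f, Jd (B f) = 0)
    (hker : ∀ f, B f = 0 → Jd f = 0 → f = 0)
    (S : Submodule ℂ H) [FiniteDimensional ℂ S] (hBS : ∀ f, B f ∈ S)
    (hPS : ∀ f, f - Ju (Jd f) ∈ S) (z : ℂ) (hz : z ∈ resolventSet ℂ (Jd ∘L A ∘L Ju)) :
    ∃ C β₀ : ℝ, 0 < C ∧ 0 < β₀ ∧ ∀ β : ℝ, β₀ ≤ β →
      z ∈ resolventSet ℂ (A + (β : ℂ) • B) ∧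
      ‖resolventOp (A + (β : ℂ) • B) z - Ju ∘L resolventOp (Jd ∘L A ∘L Ju) z ∘L Jd‖ ≤ C / β := by
  set P : H →L[ℂ] H := Ju ∘L Jd with hP
  have hPa : ∀ f, P f = Ju (Jd f) := fun f => rfl
  have hinj : Function.Injective (B + P) := by
    rw [injective_iff_map_eq_zero]
    intro f hf
    have h1 : B f + Ju (Jd f) = 0 := hf
    have h2 := congrArg Jd h1
    rw [map_add, hJB, hJ, map_zero, zero_add] at h2
    rw [h2, map_zero, add_zero] at h1
    exact hker f h1 h2
  have hsurj : Function.Surjective (B + P) :=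
    surjective_of_injective_of_range_sub_le (B + P : H →L[ℂ] H).toLinearMap S (fun f => by
      have := S.sub_mem (hPS f) (hBS f)
      convert this using 1
      change f - (B f + Ju (Jd f)) = _
      abel) hinj
  let e := ContinuousLinearEquiv.ofBijective (B + P) (LinearMap.ker_eq_bot.2 hinj)
    (LinearMap.range_eq_top.2 hsurj)
  have he : ∀ f, e f = B f + Ju (Jd f) := fun f => rfl
  have heP : ∀ f, e.symm (Ju (Jd f)) = Ju (Jd f) := fun f => by
    rw [ContinuousLinearEquiv.symm_apply_eq, he, hBJ, hJ, zero_add]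
  have hJe : ∀ f, Jd (e.symm f) = Jd f := fun f => by
    have h := congrArg Jd (he (e.symm f))
    rwa [ContinuousLinearEquiv.apply_symm_apply, map_add, hJB, zero_add, hJ, eq_comm] at h
  -- `(B + P)⁻¹` is the identity on the range of `P`; subtracting `P` leaves the inverse of `B` on
  -- the complement, extended by zero.
  set T : H →L[ℂ] H := (e.symm : H →L[ℂ] H) - P with hT
  have hTa : ∀ f, T f = e.symm f - Ju (Jd f) := fun f => rfl
  set r := resolventOp (Jd ∘L A ∘L Ju) z with hr
  have hu : IsUnit (Jd ∘L A ∘L Ju - z • (1 : H' →L[ℂ] H')) := by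
    have := (spectrum.mem_resolventSet_iff.1 hz).neg
    rwa [neg_sub, Algebra.algebraMap_eq_smul_one] at this
  have hr1 : ∀ g, r (Jd (A (Ju g)) - z • g) = g := fun g =>
    congrArg (fun t : H' →L[ℂ] H' => t g) (Ring.inverse_mul_cancel _ hu)
  have hr2 : ∀ g, Jd (A (Ju (r g))) - z • r g = g := fun g =>
    congrArg (fun t : H' →L[ℂ] H' => t g) (Ring.mul_inverse_cancel _ hu)
  obtain ⟨C, β₀, hC, hβ₀, h⟩ := inverse_add_smul_sub_le (A := H →L[ℂ] H)
    (D := A - z • 1) (B := B) (P := P) (T := T) (R := Ju ∘L r ∘L Jd)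
    (by
      ext f
      change B (T f) = f - Ju (Jd f)
      have h := he (e.symm f)
      rw [ContinuousLinearEquiv.apply_symm_apply, hJe] at h
      rw [hTa, map_sub, hBJ, sub_zero, eq_sub_iff_add_eq, ← h])
    (by
      ext f
      change T (B f) = f - Ju (Jd f)
      rw [hTa, hJB, map_zero, sub_zero, ContinuousLinearEquiv.symm_apply_eq, he, map_sub, map_sub,
        map_sub, hBJ, hJ]
      simp)
    (by ext f; exact hBJ _)
    (by
      ext f
      change Ju (r (Jd (B f))) = 0
      rw [hJB, map_zero, map_zero])
    (by
      ext f
      change Ju (Jd (A (Ju (r (Jd f))) - z • Ju (r (Jd f)))) = Ju (Jd f)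
      rw [map_sub, map_smul, hJ, hr2])
    (by
      ext f
      change Ju (r (Jd (A (Ju (Jd f)) - z • Ju (Jd f)))) = Ju (Jd f)
      rw [map_sub, map_smul, hJ, hr1])
  refine ⟨C, β₀, hC, hβ₀, fun β hβ => ?_⟩
  obtain ⟨h1, h2⟩ := h β hβ
  have hX : A - z • (1 : H →L[ℂ] H) + (β : ℂ) • B = A + (β : ℂ) • B - z • 1 := by abel
  rw [hX] at h1 h2
  refine ⟨?_, h2⟩
  rw [spectrum.mem_resolventSet_iff, Algebra.algebraMap_eq_smul_one]
  have := h1.neg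
  rwa [neg_sub] at this

end Perturbation

/-! ### Combinatorics of reaches and cabals -/

section Reaches

variable {V : Type*} {F : Set (V × V)}

/-- The vertices that belong to an edge in `F`. -/
def touched (F : Set (V × V)) : Set V := Prod.fst '' F ∪ Prod.snd '' F

theorem touched_finite (hF : F.Finite) : (touched F).Finite :=
  (hF.image _).union (hF.image _)

theorem HasPath.refl (v : V) : HasPath F v v := Relation.ReflTransGen.refl

theorem HasPath.trans {u v w : V} (h : HasPath F u v) (h' : HasPath F v w) : HasPath F u w :=
  Relation.ReflTransGen.trans h h'

theorem HasPath.of_mem {u v : V} (h : (v, u) ∈ F) : HasPath F u v :=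
  Relation.ReflTransGen.single h

/-- The source of all finiteness: a nontrivial path begins and ends at endpoints of the finite set
`F`. -/
theorem HasPath.eq_or_touched {i j : V} (h : HasPath F i j) :
    i = j ∨ (i ∈ touched F ∧ j ∈ touched F) := by
  induction h with
  | refl => exact Or.inl rfl
  | tail _ h ih =>
    have hb : _ ∈ touched F := Or.inr (Set.mem_image_of_mem Prod.snd h)
    have hc : _ ∈ touched F := Or.inl (Set.mem_image_of_mem Prod.fst h)
    rcases ih with rfl | ⟨h1, -⟩
    · exact Or.inr ⟨hb, hc⟩
    · exact Or.inr ⟨h1, hc⟩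

theorem finite_past (hF : F.Finite) (x : V) : {v | HasPath F v x}.Finite :=
  ((touched_finite hF).insert x).subset fun _ hv => hv.eq_or_touched.imp id fun h => h.1

theorem finite_reachableSet (hF : F.Finite) (x : V) : (reachableSet F x).Finite :=
  ((touched_finite hF).insert x).subset fun _ hv =>
    (HasPath.eq_or_touched hv).imp Eq.symm fun h => h.2

namespace Reach

theorem finite (hF : F.Finite) (R : Reach F) : R.1.Finite := by
  obtain ⟨i, hi⟩ := R.2.prop
  exact hi ▸ finite_reachableSet hF i

theorem mem_of_hasPath {R : Reach F} {v w : V} (hv : v ∈ R.1) (h : HasPath F v w) :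
    w ∈ R.1 := by
  obtain ⟨i, hi⟩ := R.2.prop
  rw [hi] at hv ⊢
  exact HasPath.trans hv h

theorem cabal_nonempty (R : Reach F) : (cabal R).Nonempty := by
  obtain ⟨i, hi⟩ := R.2.prop
  exact ⟨i, hi ▸ HasPath.refl i, hi ▸ Set.Subset.rfl⟩

theorem cabal_subset (R : Reach F) : cabal R ⊆ R.1 := fun _ h => h.1

theorem hasPath_of_mem_cabal {R : Reach F} {i v : V} (hi : i ∈ cabal R) (hv : v ∈ R.1) :
    HasPath F i v := hi.2 hv

/-- All of `R` is reached from `i`, hence lies in `S`; maximality of `R` forces equality. So a cabal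
meets no other reach. -/
theorem eq_of_mem_cabal {R S : Reach F} {i : V} (hi : i ∈ cabal R) (hS : i ∈ S.1) : S = R := by
  have h : R.1 ⊆ S.1 := fun _ hv => mem_of_hasPath hS (hi.2 hv)
  exact Subtype.ext ((R.2.eq_of_le S.2.prop h).symm)

/-- A predecessor of `i` reaches at least `R`, and by maximality no more. -/
theorem mem_cabal_of_hasPath {R : Reach F} {i j : V} (hi : i ∈ cabal R) (h : HasPath F j i) :
    j ∈ cabal R := by
  have h1 : R.1 ⊆ reachableSet F j := fun _ hv => h.trans (hi.2 hv)
  have h2 : R.1 = reachableSet F j := R.2.eq_of_le ⟨j, rfl⟩ h1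
  exact ⟨h2 ▸ HasPath.refl j, h1⟩

/-- Among the finitely many reachable sets started in the past of `v`, take a maximal one. It is
maximal globally, because the starting point of a larger one would again lie in the past of `v`. -/
theorem exists_mem_cabal_hasPath (hF : F.Finite) (v : V) :
    ∃ R : Reach F, ∃ i ∈ cabal R, HasPath F i v := by
  have hfin : {S | ∃ i, HasPath F i v ∧ S = reachableSet F i}.Finite := by
    refine ((finite_past hF v).image (reachableSet F)).subset ?_
    rintro S ⟨i, hi, rfl⟩
    exact ⟨i, hi, rfl⟩
  obtain ⟨S, -, hS⟩ := hfin.exists_le_maximal ⟨v, HasPath.refl v, rfl⟩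
  obtain ⟨i, hi, rfl⟩ := hS.prop
  have hR : IsReach F (reachableSet F i) := by
    refine ⟨⟨i, rfl⟩, ?_⟩
    rintro _ ⟨k, rfl⟩ hle
    exact hS.2 ⟨k, hle hi, rfl⟩ hle
  exact ⟨⟨_, hR⟩, i, ⟨HasPath.refl i, Set.Subset.rfl⟩, hi⟩

theorem exists_mem (hF : F.Finite) (v : V) : ∃ R : Reach F, v ∈ R.1 := by
  obtain ⟨R, i, hi, h⟩ := exists_mem_cabal_hasPath hF v
  exact ⟨R, mem_of_hasPath hi.1 h⟩

theorem finite_setOf_mem (hF : F.Finite) (v : V) : {R : Reach F | v ∈ R.1}.Finite := by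
  refine Set.Finite.of_finite_image (f := Subtype.val)
    (((finite_past hF v).image (reachableSet F)).subset ?_) Subtype.val_injective.injOn
  rintro _ ⟨R, hR, rfl⟩
  obtain ⟨i, hi⟩ := R.2.prop
  exact ⟨i, hi.subset hR, hi.symm⟩

theorem cabal_eq_singleton_of_not_touched {R : Reach F} {v : V}
    (hv : v ∉ touched F) (hR : v ∈ R.1) :
    cabal R = {v} := by
  have key : ∀ i ∈ cabal R, i = v := fun i hi =>
    (hasPath_of_mem_cabal hi hR).eq_or_touched.resolve_right fun h => hv h.2
  exact R.cabal_nonempty.subset_singleton_iff.1 key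

theorem cabal_subset_exclusivePart (R : Reach F) : cabal R ⊆ exclusivePart R :=
  fun _ hi => ⟨hi.1, fun _ hS _ hk hp => hS (eq_of_mem_cabal hi (mem_of_hasPath hk hp))⟩

end Reach

/-! ### Minimum principle and right kernel vectors -/

variable {G : WeightedDigraph V}

namespace WeightedDigraph

theorem inDegree_eq_sum {x : V} {T : Finset V} (hT : ∀ y ∉ T, G.weight x y = 0) :
    G.inDegree x = ∑ y ∈ T, G.weight x y := tsum_eq_sum hT

theorem inLaplacian_eq_sum {𝕜 : Type*} [RCLike 𝕜] {x : V} {T : Finset V}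
    (hT : ∀ y ∉ T, G.weight x y = 0) (f : V → 𝕜) :
    G.inLaplacian f x = (G.mass x : 𝕜)⁻¹ * ∑ y ∈ T, (G.weight x y : 𝕜) * (f x - f y) := by
  rw [inLaplacian, inDegree_eq_sum hT, tsum_eq_sum (s := T) fun _ hy => by simp [hT _ hy]]
  simp only [mul_sub, Finset.sum_sub_distrib, ← Finset.sum_mul]
  push_cast
  rfl

theorem restrict_weight_of_notMem {x y : V} (h : (x, y) ∉ F) : (G.restrict F).weight x y = 0 :=
  if_neg h

theorem restrict_weight_of_mem {x y : V} (h : (x, y) ∈ F) :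
    (G.restrict F).weight x y = G.weight x y := if_pos h

theorem restrict_weight_of_notMem_toFinset (hF : F.Finite) (x : V) :
    ∀ y ∉ (touched_finite hF).toFinset, (G.restrict F).weight x y = 0 := fun y hy =>
  restrict_weight_of_notMem fun h => hy <| (Set.Finite.mem_toFinset _).2 <|
    Or.inr (Set.mem_image_of_mem Prod.snd h)

/-- The in-degree Laplacian of `(V, F)` without the factor `1 / m`. -/
noncomputable def coreLaplacian {𝕜 : Type*} [RCLike 𝕜] (G : WeightedDigraph V) (hF : F.Finite)
    (f : V → 𝕜) (x : V) : 𝕜 :=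
  ∑ y ∈ (touched_finite hF).toFinset, ((G.restrict F).weight x y : 𝕜) * (f x - f y)

theorem inLaplacian_restrict {𝕜 : Type*} [RCLike 𝕜] (hF : F.Finite) (f : V → 𝕜) (x : V) :
    (G.restrict F).inLaplacian f x = (G.mass x : 𝕜)⁻¹ * G.coreLaplacian hF f x :=
  inLaplacian_eq_sum (restrict_weight_of_notMem_toFinset hF x) f

theorem inLaplacian_restrict_eq_zero {𝕜 : Type*} [RCLike 𝕜] (hF : F.Finite) {f : V → 𝕜} {x : V} :
    (G.restrict F).inLaplacian f x = 0 ↔ G.coreLaplacian hF f x = 0 := by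
  have h : (G.mass x : 𝕜) ≠ 0 := by exact_mod_cast (G.mass_pos x).ne'
  rw [inLaplacian_restrict hF, mul_eq_zero, inv_eq_zero, or_iff_right h]

section

variable {𝕜 : Type*} [RCLike 𝕜] {hF : F.Finite}

theorem coreLaplacian_add (f g : V → 𝕜) (x : V) :
    G.coreLaplacian hF (f + g) x = G.coreLaplacian hF f x + G.coreLaplacian hF g x := by
  simp only [coreLaplacian, ← Finset.sum_add_distrib, Pi.add_apply]
  exact Finset.sum_congr rfl fun y _ => by ring

theorem coreLaplacian_sub (f g : V → 𝕜) (x : V) :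
    G.coreLaplacian hF (f - g) x = G.coreLaplacian hF f x - G.coreLaplacian hF g x := by
  simp only [coreLaplacian, ← Finset.sum_sub_distrib, Pi.sub_apply]
  exact Finset.sum_congr rfl fun y _ => by ring

theorem coreLaplacian_smul (c : 𝕜) (f : V → 𝕜) (x : V) :
    G.coreLaplacian hF (c • f) x = c * G.coreLaplacian hF f x := by
  simp only [coreLaplacian, Finset.mul_sum, Pi.smul_apply, smul_eq_mul]
  exact Finset.sum_congr rfl fun y _ => by ring

theorem coreLaplacian_neg (f : V → 𝕜) (x : V) :
    G.coreLaplacian hF (-f) x = -G.coreLaplacian hF f x := by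
  simpa using coreLaplacian_smul (G := G) (hF := hF) (-1 : 𝕜) f x

theorem coreLaplacian_const (c : 𝕜) (x : V) : G.coreLaplacian hF (fun _ => c) x = 0 := by
  simp [coreLaplacian]

/-- The triangle inequality makes `-‖g‖` superharmonic, so the real minimum principle also handles
complex functions. -/
theorem coreLaplacian_neg_norm_nonneg {g : V → 𝕜} {x : V} (h : G.coreLaplacian hF g x = 0) :
    0 ≤ G.coreLaplacian hF (fun y => -‖g y‖) x := by
  have hnn : ∀ y, 0 ≤ (G.restrict F).weight x y := (G.restrict F).weight_nonneg x
  simp only [coreLaplacian, mul_sub, Finset.sum_sub_distrib, sub_eq_zero] at h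
  simp only [coreLaplacian, mul_sub, Finset.sum_sub_distrib, mul_neg, Finset.sum_neg_distrib]
  have h1 : ∑ y ∈ (touched_finite hF).toFinset, (G.restrict F).weight x y * ‖g x‖ =
      ‖∑ y ∈ (touched_finite hF).toFinset, ((G.restrict F).weight x y : 𝕜) * g x‖ := by
    rw [← Finset.sum_mul, ← Finset.sum_mul, norm_mul, ← RCLike.ofReal_sum,
      RCLike.norm_of_nonneg (Finset.sum_nonneg fun y _ => hnn y)]
  have h2 : ‖∑ y ∈ (touched_finite hF).toFinset, ((G.restrict F).weight x y : 𝕜) * g y‖ ≤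
      ∑ y ∈ (touched_finite hF).toFinset, (G.restrict F).weight x y * ‖g y‖ :=
    (norm_sum_le _ _).trans (le_of_eq (Finset.sum_congr rfl fun y _ => by
      rw [norm_mul, RCLike.norm_of_nonneg (hnn y)]))
  simp only [RCLike.ofReal_real_eq_id, id_eq]
  rw [h1, h]
  linarith

/-- Minimum principle: a superharmonic function that is minimal at `x` is constant on the vertices
that `x` sees. -/
theorem eq_of_hasPath_of_superharmonic (hFE : F ⊆ G.edgeSet) {h : V → ℝ} {x : V}
    (hsup : ∀ v, HasPath F v x → 0 ≤ G.coreLaplacian hF h v)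
    (hmin : ∀ v, HasPath F v x → h x ≤ h v) {v : V} (hv : HasPath F v x) : h v = h x := by
  induction hv using Relation.ReflTransGen.head_induction_on with
  | refl => rfl
  | @head v w hvw hw ih =>
    have hwx : HasPath F w x := hw
    have hterm : ∀ y ∈ (touched_finite hF).toFinset,
        (G.restrict F).weight w y * (h w - h y) ≤ 0 := fun y _ => by
      by_cases hy : (w, y) ∈ F
      · exact mul_nonpos_of_nonneg_of_nonpos ((G.restrict F).weight_nonneg w y)
          (by linarith [hmin y ((HasPath.of_mem hy).trans hwx)])
      · simp [restrict_weight_of_notMem hy]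
    -- At a minimum every term is nonpositive while their sum is nonnegative, so each term vanishes.
    have hsum := le_antisymm (Finset.sum_nonpos hterm) (hsup w hwx)
    have hz := (Finset.sum_eq_zero_iff_of_nonpos hterm).1 hsum v
      ((Set.Finite.mem_toFinset _).2 (Or.inr (Set.mem_image_of_mem Prod.snd hvw)))
    have hpos : 0 < (G.restrict F).weight w v := by
      rw [restrict_weight_of_mem hvw]; exact hFE hvw
    rcases mul_eq_zero.1 hz with h0 | h0
    · exact absurd h0 hpos.ne'
    · linarith

/-- The minimum over the finite past of `x` is attained, and it propagates back to a cabal: cabals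
are the boundary. -/
theorem le_of_superharmonic (hFE : F ⊆ G.edgeSet) {h : V → ℝ} {x : V} {c : ℝ}
    (hsup : ∀ v, HasPath F v x → 0 ≤ G.coreLaplacian hF h v)
    (hc : ∀ R : Reach F, ∀ i ∈ cabal R, HasPath F i x → c ≤ h i) : c ≤ h x := by
  obtain ⟨v, hv, hmin⟩ := (finite_past hF x).exists_minimalFor h _ ⟨x, HasPath.refl x⟩
  have hmin' : ∀ w, HasPath F w x → h v ≤ h w := fun w hw => by
    rcases le_total (h v) (h w) with h1 | h1
    · exact h1
    · exact hmin hw h1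
  obtain ⟨R, i, hi, hiv⟩ := Reach.exists_mem_cabal_hasPath hF v
  have h1 := eq_of_hasPath_of_superharmonic hFE (fun w hw => hsup w (hw.trans hv))
    (fun w hw => hmin' w (hw.trans hv)) hiv
  linarith [hc R i hi (hiv.trans hv), hmin' x (HasPath.refl x)]

theorem eq_zero_of_harmonic (hFE : F ⊆ G.edgeSet) {g : V → 𝕜} {x : V}
    (hg : ∀ v, HasPath F v x → G.coreLaplacian hF g v = 0)
    (hc : ∀ R : Reach F, ∀ i ∈ cabal R, HasPath F i x → g i = 0) : g x = 0 := by
  have := le_of_superharmonic (h := fun y => -‖g y‖) (c := 0) hFE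
    (fun v hv => coreLaplacian_neg_norm_nonneg (hg v hv)) fun R i hi hp => by simp [hc R i hi hp]
  simpa using this

theorem eq_of_harmonic_of_mem_cabal (hFE : F ⊆ G.edgeSet) {g : V → 𝕜} {R : Reach F}
    (hg : ∀ v ∈ cabal R, G.coreLaplacian hF g v = 0) {i j : V} (hi : i ∈ cabal R)
    (hj : j ∈ cabal R) : g j = g i := by
  have hfin : (cabal R).Finite := (R.finite hF).subset R.cabal_subset
  -- The minimum of `h` over the cabal propagates to `i`, where `h` has its largest possible value
  -- 0; so `h` vanishes on the cabal.
  set h : V → ℝ := fun y => -‖g y - g i‖ with hh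
  obtain ⟨v, hv, hmin⟩ := hfin.exists_minimalFor h _ ⟨i, hi⟩
  have hmin' : ∀ w ∈ cabal R, h v ≤ h w := fun w hw => by
    rcases le_total (h v) (h w) with h1 | h1
    · exact h1
    · exact hmin hw h1
  have h1 : h i = h v := eq_of_hasPath_of_superharmonic (hF := hF) hFE
    (fun w hw => coreLaplacian_neg_norm_nonneg (g := g - fun _ => g i) (by
      rw [coreLaplacian_sub, coreLaplacian_const, hg w (Reach.mem_cabal_of_hasPath hv hw),
        sub_zero]))
    (fun w hw => hmin' w (Reach.mem_cabal_of_hasPath hv hw))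
    (Reach.hasPath_of_mem_cabal hi hv.1)
  have h2 := hmin' j hj
  rw [← h1] at h2
  simp only [hh, sub_self, norm_zero, neg_zero, Left.nonneg_neg_iff, norm_le_zero_iff,
    sub_eq_zero] at h2
  exact h2

theorem coreLaplacian_eq_zero_of_not_touched {x : V} (hx : x ∉ touched F) (f : V → 𝕜) :
    G.coreLaplacian hF f x = 0 :=
  Finset.sum_eq_zero fun y _ => by
    rw [restrict_weight_of_notMem fun h => hx (Or.inl (Set.mem_image_of_mem Prod.fst h))]
    simp

/-- A function that is constant on a cabal is harmonic there. -/
theorem coreLaplacian_eq_zero_of_mem_cabal {R : Reach F} {f : V → 𝕜} {c : 𝕜}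
    (hf : ∀ i ∈ cabal R, f i = c) {x : V} (hx : x ∈ cabal R) : G.coreLaplacian hF f x = 0 :=
  Finset.sum_eq_zero fun y _ => by
    by_cases hy : (x, y) ∈ F
    · rw [hf x hx, hf y (Reach.mem_cabal_of_hasPath hx (HasPath.of_mem hy)), sub_self, mul_zero]
    · simp [restrict_weight_of_notMem hy]

end

theorem finiteDimensional_of_support {𝕜 E : Type*} [Field 𝕜] [AddCommGroup E] [Module 𝕜 E]
    (φ : E →ₗ[𝕜] V → 𝕜) (hφ : Function.Injective φ) {N : Set V} (hN : N.Finite)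
    (S : Submodule 𝕜 E) (hS : ∀ f ∈ S, ∀ v ∉ N, φ f v = 0) : FiniteDimensional 𝕜 S := by
  have := hN.fintype
  refine Module.Finite.of_injective
    (LinearMap.funLeft 𝕜 𝕜 (Subtype.val : N → V) ∘ₗ φ ∘ₗ S.subtype) fun f g h => ?_
  refine Subtype.ext (hφ (funext fun v => ?_))
  by_cases hv : v ∈ N
  · exact congrFun h ⟨v, hv⟩
  · rw [hS f f.2 v hv, hS g g.2 v hv]

/-- A Dirichlet problem with boundary data on the cabals. The operator `T` below is the Laplacian
off the cabals and the identity on them; it is injective by the minimum principle, and `1 - T` has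
values supported on a finite set. Harmonicity on a cabal is automatic, since the data are constant
there. -/
theorem exists_harmonic_extension (hFE : F ⊆ G.edgeSet) (hF : F.Finite) (R : Reach F) :
    ∃ γ : V → ℝ, (∀ x, G.coreLaplacian hF γ x = 0) ∧ (∀ i ∈ cabal R, γ i = 1) ∧
      ∀ S : Reach F, S ≠ R → ∀ i ∈ cabal S, γ i = 0 := by
  classical
  set N : Set V := {v | ∀ S : Reach F, v ∉ cabal S} with hN
  have hNt : N ⊆ touched F := fun v hv => by
    by_contra h
    obtain ⟨S, hS⟩ := Reach.exists_mem hF v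
    exact hv S (by rw [Reach.cabal_eq_singleton_of_not_touched h hS]; rfl)
  let T : (V → ℝ) →ₗ[ℝ] (V → ℝ) :=
    { toFun := fun f x => if x ∈ N then G.coreLaplacian hF f x else f x
      map_add' := fun f g => funext fun x => by
        by_cases h : x ∈ N <;> simp [h, coreLaplacian_add]
      map_smul' := fun c f => funext fun x => by
        by_cases h : x ∈ N <;> simp [h, coreLaplacian_smul] }
  have hTN : ∀ f x, x ∈ N → T f x = G.coreLaplacian hF f x := fun f x hx => if_pos hx
  have hTc : ∀ f x, x ∉ N → T f x = f x := fun f x hx => if_neg hx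
  have hcN : ∀ (S : Reach F), ∀ i ∈ cabal S, i ∉ N := fun S i hi h => h S hi
  let W : Submodule ℝ (V → ℝ) :=
    { carrier := {f | ∀ v ∉ N, f v = 0}
      add_mem' := fun hf hg v hv => by simp [hf v hv, hg v hv]
      zero_mem' := fun _ _ => rfl
      smul_mem' := fun c f hf v hv => by simp [hf v hv] }
  have : FiniteDimensional ℝ W := finiteDimensional_of_support LinearMap.id
    Function.injective_id ((touched_finite hF).subset hNt) W fun _ hf v hv => hf v hv
  have hinj : Function.Injective T := by
    rw [injective_iff_map_eq_zero]
    intro f hf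
    have hfc : ∀ (S : Reach F), ∀ i ∈ cabal S, f i = 0 := fun S i hi => by
      rw [← hTc f i (hcN S i hi), hf]; rfl
    refine funext fun x => eq_zero_of_harmonic (hF := hF) hFE (fun v _ => ?_)
      fun S i hi _ => hfc S i hi
    by_cases hv : v ∈ N
    · rw [← hTN f v hv, hf]; rfl
    · obtain ⟨S, hS⟩ := not_forall_not.1 hv
      exact coreLaplacian_eq_zero_of_mem_cabal (hfc S) hS
  obtain ⟨γ, hγ⟩ := surjective_of_injective_of_range_sub_le T W
    (fun f v hv => by rw [Pi.sub_apply, hTc f v hv, sub_self]) hinj ((cabal R).indicator 1)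
  have h1 : ∀ i ∈ cabal R, γ i = 1 := fun i hi => by
    rw [← hTc γ i (hcN R i hi), hγ, Set.indicator_of_mem hi, Pi.one_apply]
  have h0 : ∀ S : Reach F, S ≠ R → ∀ i ∈ cabal S, γ i = 0 := fun S hS i hi => by
    rw [← hTc γ i (hcN S i hi), hγ, Set.indicator_of_notMem]
    exact fun h => hS (Reach.eq_of_mem_cabal h hi.1)
  refine ⟨γ, fun x => ?_, h1, h0⟩
  by_cases hx : x ∈ N
  · rw [← hTN γ x hx, hγ, Set.indicator_of_notMem (hx R)]
  · obtain ⟨S, hS⟩ := not_forall_not.1 hx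
    by_cases hSR : S = R
    · exact coreLaplacian_eq_zero_of_mem_cabal (hSR ▸ h1) hS
    · exact coreLaplacian_eq_zero_of_mem_cabal (h0 S hSR) hS

theorem existsUnique_isRightKernelVector (hFE : F ⊆ G.edgeSet) (hF : F.Finite) (R : Reach F) :
    ∃! γ : V → ℝ, G.IsRightKernelVector R γ := by
  refine existsUnique_of_exists_of_unique ?_ ?_
  · obtain ⟨γ, hγ, h1, h0⟩ := exists_harmonic_extension hFE hF R
    have hge : ∀ x, 0 ≤ γ x := fun x => le_of_superharmonic (hF := hF) hFE
      (fun v _ => (hγ v).ge) fun S i hi _ => by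
        by_cases hS : S = R
        · subst hS; rw [h1 i hi]; exact zero_le_one
        · rw [h0 S hS i hi]
    have hγn : ∀ v, G.coreLaplacian hF (-γ) v = 0 := fun v => by
      rw [coreLaplacian_neg, hγ, neg_zero]
    have hle : ∀ x, -1 ≤ (-γ) x := fun x => le_of_superharmonic (hF := hF) hFE
      (fun v _ => (hγn v).ge) fun S i hi _ => by
        by_cases hS : S = R
        · subst hS; rw [Pi.neg_apply, h1 i hi]
        · rw [Pi.neg_apply, h0 S hS i hi]; norm_num
    refine ⟨γ, fun x => (inLaplacian_restrict_eq_zero hF).2 (hγ x), ?_, ?_, ?_⟩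
    · intro j hj
      have : (γ - fun _ => (1 : ℝ) : V → ℝ) j = 0 := eq_zero_of_harmonic (hF := hF) hFE
        (fun v _ => by rw [coreLaplacian_sub, hγ, coreLaplacian_const, sub_zero])
        fun S i hi hp => by
          by_cases hS : S = R
          · subst hS; rw [Pi.sub_apply, h1 i hi, sub_self]
          · exact absurd hp (hj.2 S hS i hi.1)
      exact sub_eq_zero.1 this
    · rintro j ⟨hjR, S, hSR, k, hk, hkj⟩
      constructor
      -- A zero at `j` would be a minimum and would propagate back to the cabal of `R`, where `γ =
      -- 1`.
      · refine lt_of_le_of_ne (hge j) fun h => ?_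
        obtain ⟨i, hi⟩ := R.cabal_nonempty
        have := eq_of_hasPath_of_superharmonic (hF := hF) hFE (fun v _ => (hγ v).ge)
          (fun v _ => h ▸ hge v) (Reach.hasPath_of_mem_cabal hi hjR)
        rw [h1 i hi, ← h] at this
        exact one_ne_zero this
      -- The value 1 at `j` would be a maximum and would propagate back to the cabal of `S`, where
      -- `γ = 0`.
      · refine lt_of_le_of_ne (by simpa using neg_le_neg (hle j)) fun h => ?_
        obtain ⟨i, hi⟩ := S.cabal_nonempty
        have := eq_of_hasPath_of_superharmonic (hF := hF) hFE (fun v _ => (hγn v).ge)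
          (fun v _ => by rw [Pi.neg_apply, h]; exact hle v)
          ((Reach.hasPath_of_mem_cabal hi hk).trans hkj)
        rw [Pi.neg_apply, Pi.neg_apply, h0 S hSR i hi, h] at this
        norm_num at this
    · intro j hj
      refine eq_zero_of_harmonic (hF := hF) hFE (fun v _ => hγ v) fun S i hi hp => h0 S ?_ i hi
      rintro rfl
      exact hj (Reach.mem_of_hasPath hi.1 hp)
  · intro γ γ' h h'
    funext x
    refine sub_eq_zero.1 (eq_zero_of_harmonic (g := γ - γ') (hF := hF) hFE (fun v _ => ?_) ?_)
    · rw [coreLaplacian_sub, (inLaplacian_restrict_eq_zero hF).1 (h.1 v),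
        (inLaplacian_restrict_eq_zero hF).1 (h'.1 v), sub_zero]
    · intro S i hi _
      rw [Pi.sub_apply]
      by_cases hS : S = R
      · subst hS
        have := S.cabal_subset_exclusivePart hi
        rw [h.2.1 i this, h'.2.1 i this, sub_self]
      · have : i ∉ R.1 := fun hR => hS (Reach.eq_of_mem_cabal hi hR).symm
        rw [h.2.2.2 i this, h'.2.2.2 i this, sub_self]

end WeightedDigraph
end Reaches

/-! ### Left kernel vectors as stationary distributions -/

section LeftVectors

variable {V : Type*} {F : Set (V × V)} {G : WeightedDigraph V}

namespace Reach

theorem finite_cabal (hF : F.Finite) (R : Reach F) : (cabal R).Finite :=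
  (R.finite hF).subset R.cabal_subset

/-- The cabal of a reach as a finite set. -/
noncomputable def cabalFinset (hF : F.Finite) (R : Reach F) : Finset V :=
  (R.finite_cabal hF).toFinset

theorem mem_cabalFinset {hF : F.Finite} {R : Reach F} {v : V} :
    v ∈ R.cabalFinset hF ↔ v ∈ cabal R := Set.Finite.mem_toFinset _

end Reach

namespace WeightedDigraph

theorem coreLaplacian_of_mem_cabal {𝕜 : Type*} [RCLike 𝕜] {hF : F.Finite} {R : Reach F}
    (f : V → 𝕜) {x : V} (hx : x ∈ cabal R) :
    G.coreLaplacian hF f x =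
      ∑ y ∈ R.cabalFinset hF, ((G.restrict F).weight x y : 𝕜) * (f x - f y) := by
  classical
  unfold coreLaplacian
  rw [← tsum_eq_sum (L := .unconditional V), ← tsum_eq_sum (L := .unconditional V)]
  · intro y hy
    rw [restrict_weight_of_notMem, RCLike.ofReal_zero, zero_mul]
    exact fun h => hy (Reach.mem_cabalFinset.2 (Reach.mem_cabal_of_hasPath hx (.of_mem h)))
  · intro y hy
    rw [restrict_weight_of_notMem_toFinset hF x y hy, RCLike.ofReal_zero, zero_mul]

theorem weightedPairing_eq_sum {𝕜 : Type*} [RCLike 𝕜] {hF : F.Finite} {R : Reach F}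
    {γ : V → ℝ} (h0 : ∀ j ∉ cabal R, γ j = 0) (f : V → 𝕜) :
    weightedPairing G.mass (fun v => (γ v : 𝕜)) f =
      ∑ x ∈ R.cabalFinset hF, ((γ x * G.mass x : ℝ) : 𝕜) * f x := by
  rw [weightedPairing, tsum_eq_sum (s := R.cabalFinset hF)]
  · refine Finset.sum_congr rfl fun x _ => ?_
    rw [RCLike.conj_ofReal]
    push_cast
    ring
  · intro x hx
    simp [h0 x fun h => hx (Reach.mem_cabalFinset.2 h)]

/-- The balance equations of a stationary distribution on the cabal of `R`. -/
def IsBalanced (G : WeightedDigraph V) (hF : F.Finite) (R : Reach F) (γ : V → ℝ) : Prop :=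
  ∀ y ∈ R.cabalFinset hF, ∑ x ∈ R.cabalFinset hF, γ x * (G.restrict F).weight x y =
    γ y * ∑ z ∈ R.cabalFinset hF, (G.restrict F).weight y z

variable {hF : F.Finite} {R : Reach F} {γ : V → ℝ}

theorem IsBalanced.pairing_eq_zero {𝕜 : Type*} [RCLike 𝕜] (h : G.IsBalanced hF R γ)
    (h0 : ∀ j ∉ cabal R, γ j = 0) (f : V → 𝕜) :
    weightedPairing G.mass (fun v => (γ v : 𝕜)) ((G.restrict F).inLaplacian f) = 0 := by
  rw [weightedPairing_eq_sum (hF := hF) h0]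
  have h1 : ∀ x ∈ R.cabalFinset hF,
      ((γ x * G.mass x : ℝ) : 𝕜) * (G.restrict F).inLaplacian f x =
        f x * ((γ x * ∑ z ∈ R.cabalFinset hF, (G.restrict F).weight x z : ℝ) : 𝕜) -
        ∑ y ∈ R.cabalFinset hF, f y * ((γ x * (G.restrict F).weight x y : ℝ) : 𝕜) := by
    intro x hx
    have hm : (G.mass x : 𝕜) ≠ 0 := by exact_mod_cast (G.mass_pos x).ne'
    rw [inLaplacian_restrict hF, coreLaplacian_of_mem_cabal f (Reach.mem_cabalFinset.1 hx)]
    push_cast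
    rw [mul_assoc, mul_inv_cancel_left₀ hm]
    simp only [Finset.mul_sum, ← Finset.sum_sub_distrib]
    exact Finset.sum_congr rfl fun y _ => by ring
  rw [Finset.sum_congr rfl h1, Finset.sum_sub_distrib, Finset.sum_comm, sub_eq_zero]
  refine Finset.sum_congr rfl fun y hy => ?_
  rw [← Finset.mul_sum, ← h y hy]
  push_cast
  rfl

/-- Testing against the unit function at `y` isolates the balance equation at `y`. -/
theorem isBalanced_of_pairing_eq_zero (h0 : ∀ j ∉ cabal R, γ j = 0)
    (h : ∀ f : V → ℝ, weightedPairing G.mass γ ((G.restrict F).inLaplacian f) = 0) :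
    G.IsBalanced hF R γ := by
  classical
  intro y hy
  have h1 := h (Pi.single y 1)
  have h2 := weightedPairing_eq_sum (G := G) (𝕜 := ℝ) (hF := hF) h0
    ((G.restrict F).inLaplacian (Pi.single y 1))
  simp only [RCLike.ofReal_real_eq_id, id_eq] at h2
  rw [h1] at h2
  have h3 : ∀ x ∈ R.cabalFinset hF,
      γ x * G.mass x * (G.restrict F).inLaplacian (Pi.single y (1 : ℝ)) x =
        (if x = y then γ x * ∑ z ∈ R.cabalFinset hF, (G.restrict F).weight x z else 0) -
          γ x * (G.restrict F).weight x y := by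
    intro x hx
    have hm : G.mass x ≠ 0 := (G.mass_pos x).ne'
    rw [inLaplacian_restrict hF, coreLaplacian_of_mem_cabal _ (Reach.mem_cabalFinset.1 hx)]
    simp only [RCLike.ofReal_real_eq_id, id_eq]
    rw [mul_assoc, mul_inv_cancel_left₀ hm]
    simp only [mul_sub, Finset.sum_sub_distrib, Pi.single_apply, mul_ite, mul_one, mul_zero,
      Finset.sum_ite_eq', if_pos hy]
    split_ifs <;> simp
  rw [Finset.sum_congr rfl h3, Finset.sum_sub_distrib, Finset.sum_ite_eq', if_pos hy] at h2
  linarith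

/-- The triangle inequality gives one inequality at each `y`; summed over `y`, both sides agree, so
all of them are equalities. -/
theorem IsBalanced.abs (h : G.IsBalanced hF R γ) : G.IsBalanced hF R fun x => |γ x| := by
  set B := R.cabalFinset hF
  have hw := (G.restrict F).weight_nonneg
  have hle : ∀ y ∈ B, |γ y| * ∑ z ∈ B, (G.restrict F).weight y z ≤
      ∑ x ∈ B, |γ x| * (G.restrict F).weight x y := fun y hy => by
    have h1 : |γ y| * ∑ z ∈ B, (G.restrict F).weight y z =
        |∑ x ∈ B, γ x * (G.restrict F).weight x y| := by
      rw [h y hy, abs_mul, abs_of_nonneg (Finset.sum_nonneg fun z _ => hw y z)]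
    rw [h1]
    refine (Finset.abs_sum_le_sum_abs _ _).trans (le_of_eq (Finset.sum_congr rfl fun x _ => ?_))
    rw [abs_mul, abs_of_nonneg (hw x y)]
  have heq : ∑ y ∈ B, |γ y| * ∑ z ∈ B, (G.restrict F).weight y z =
      ∑ y ∈ B, ∑ x ∈ B, |γ x| * (G.restrict F).weight x y := by
    rw [Finset.sum_comm]
    exact Finset.sum_congr rfl fun x _ => Finset.mul_sum _ _ _
  exact fun y hy => ((Finset.sum_eq_sum_iff_of_le hle).1 heq y hy).symm

theorem IsBalanced.linear_comb {γ' : V → ℝ} (h : G.IsBalanced hF R γ)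
    (h' : G.IsBalanced hF R γ') (c d : ℝ) :
    G.IsBalanced hF R fun x => c * γ x + d * γ' x := fun y hy => by
  simp only [add_mul, Finset.sum_add_distrib, mul_assoc, ← Finset.mul_sum]
  rw [h y hy, h' y hy]

/-- The balance equation at a zero forces zeros at its successors in the cabal, and the cabal is
strongly connected. -/
theorem IsBalanced.pos_or_eq_zero (hFE : F ⊆ G.edgeSet) (h : G.IsBalanced hF R γ)
    (hγ : ∀ x ∈ cabal R, 0 ≤ γ x) :
    (∀ x ∈ cabal R, 0 < γ x) ∨ ∀ x ∈ cabal R, γ x = 0 := by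
  by_contra! hcon
  obtain ⟨⟨y, hy, hy0⟩, ⟨x, hx, hx0⟩⟩ := hcon
  have hp : HasPath F y x := Reach.hasPath_of_mem_cabal hy hx.1
  refine hx0 ?_
  replace hy0 := le_antisymm hy0 (hγ y hy)
  clear hy
  induction hp using Relation.ReflTransGen.head_induction_on with
  | refl => exact hy0
  | @head u v huv hv ih =>
    have hvx : HasPath F v x := hv
    have hvB := Reach.mem_cabal_of_hasPath hx hvx
    have huB := Reach.mem_cabal_of_hasPath hvB (.of_mem huv)
    refine ih ?_
    have h1 := h u (Reach.mem_cabalFinset.2 huB)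
    rw [hy0, zero_mul, Finset.sum_eq_zero_iff_of_nonneg fun w hw =>
      mul_nonneg (hγ w (Reach.mem_cabalFinset.1 hw)) ((G.restrict F).weight_nonneg _ _)] at h1
    have h2 := h1 v (Reach.mem_cabalFinset.2 hvB)
    have hpos : 0 < (G.restrict F).weight v u := by
      rw [restrict_weight_of_mem huv]; exact hFE huv
    exact (mul_eq_zero.1 h2).resolve_right hpos.ne'

/-- The matrix of the Laplacian on the cabal kills constants, so it is singular and also has a left
null vector. -/
theorem exists_isBalanced (G : WeightedDigraph V) (hF : F.Finite) (R : Reach F) :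
    ∃ γ : V → ℝ, G.IsBalanced hF R γ ∧ (∀ j ∉ cabal R, γ j = 0) ∧ ∃ j, γ j ≠ 0 := by
  classical
  set B := R.cabalFinset hF with hB
  let M : Matrix B B ℝ := fun x y =>
    (if x = y then ∑ z ∈ B, (G.restrict F).weight x z else 0) - (G.restrict F).weight x y
  have hne : Nonempty B := by
    obtain ⟨i, hi⟩ := R.cabal_nonempty
    exact ⟨⟨i, Reach.mem_cabalFinset.2 hi⟩⟩
  have hdet : M.det = 0 := by
    refine Matrix.exists_mulVec_eq_zero_iff.1 ⟨fun _ => 1, ?_, ?_⟩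
    · exact fun h => one_ne_zero (congrFun h hne.some)
    · funext x
      simp only [Matrix.mulVec, dotProduct, M, mul_one, Finset.sum_sub_distrib,
        Finset.sum_ite_eq, Finset.mem_univ, if_true, Pi.zero_apply]
      rw [Finset.sum_coe_sort B fun y => (G.restrict F).weight x y, sub_self]
  obtain ⟨v, hv0, hv⟩ := Matrix.exists_vecMul_eq_zero_iff.2 hdet
  let γ : V → ℝ := fun x => if h : x ∈ B then v ⟨x, h⟩ else 0
  have hγ : ∀ x : B, γ x = v x := fun x => dif_pos x.2
  refine ⟨γ, fun y hy => ?_, fun j hj => dif_neg fun h => hj (Reach.mem_cabalFinset.1 h), ?_⟩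
  · have h1 := congrFun hv ⟨y, hy⟩
    simp only [Matrix.vecMul, dotProduct, M, mul_sub, Finset.sum_sub_distrib, mul_ite, mul_zero,
      Finset.sum_ite_eq', Finset.mem_univ, if_true, Pi.zero_apply, ← hγ] at h1
    rw [Finset.sum_coe_sort B fun x => γ x * (G.restrict F).weight x y] at h1
    linarith
  · obtain ⟨x, hx⟩ := Function.ne_iff.1 hv0
    exact ⟨x, by rw [hγ]; exact hx⟩

theorem tsum_mul_mass (h0 : ∀ j ∉ cabal R, γ j = 0) :
    ∑' j, γ j * G.mass j = ∑ j ∈ R.cabalFinset hF, γ j * G.mass j :=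
  tsum_eq_sum fun j hj => by simp [h0 j fun h => hj (Reach.mem_cabalFinset.2 h)]

theorem existsUnique_isLeftKernelVector (hFE : F ⊆ G.edgeSet) (hF : F.Finite) (R : Reach F) :
    ∃! γ : V → ℝ, G.IsLeftKernelVector R γ := by
  have hsumpos : ∀ γ : V → ℝ, (∀ x ∈ cabal R, 0 < γ x) →
      0 < ∑ j ∈ R.cabalFinset hF, γ j * G.mass j := fun γ hγ => by
    obtain ⟨i, hi⟩ := R.cabal_nonempty
    exact Finset.sum_pos (fun j hj => mul_pos (hγ j (Reach.mem_cabalFinset.1 hj)) (G.mass_pos j))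
      ⟨i, Reach.mem_cabalFinset.2 hi⟩
  refine existsUnique_of_exists_of_unique ?_ ?_
  · obtain ⟨γ, hγ, h0, j, hj⟩ := exists_isBalanced G hF R
    have hjB : j ∈ cabal R := by
      by_contra h
      exact hj (h0 j h)
    have hpos := (hγ.abs.pos_or_eq_zero hFE fun x _ => abs_nonneg (γ x)).resolve_right fun h =>
      hj (abs_eq_zero.1 (h j hjB))
    have hs := hsumpos _ hpos
    set s := ∑ j ∈ R.cabalFinset hF, |γ j| * G.mass j
    have h0' : ∀ j ∉ cabal R, s⁻¹ * |γ j| + 0 * |γ j| = 0 := fun j hj => by simp [h0 j hj]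
    -- The coefficient 0 reduces the linear combination to a rescaling.
    have hbal := hγ.abs.linear_comb hγ.abs s⁻¹ 0
    refine ⟨fun x => s⁻¹ * |γ x| + 0 * |γ x|, fun f => ?_, fun x hx => ?_, h0', ?_⟩
    · exact hbal.pairing_eq_zero h0' f
    · have := hpos x hx
      simp only [zero_mul, add_zero]
      positivity
    · rw [tsum_mul_mass (hF := hF) h0']
      simp only [zero_mul, add_zero, mul_assoc, ← Finset.mul_sum]
      exact inv_mul_cancel₀ hs.ne'
  · intro γ γ' h h'
    have hb := (isBalanced_of_pairing_eq_zero (hF := hF) h.2.2.1 h.1).linear_comb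
      (isBalanced_of_pairing_eq_zero h'.2.2.1 h'.1) 1 (-1)
    have hs : ∑ j ∈ R.cabalFinset hF, (γ j - γ' j) * G.mass j = 0 := by
      simp only [sub_mul, Finset.sum_sub_distrib]
      rw [← tsum_mul_mass h.2.2.1, ← tsum_mul_mass h'.2.2.1, h.2.2.2, h'.2.2.2, sub_self]
    have hd : ∀ x, 1 * γ x + -1 * γ' x = γ x - γ' x := fun x => by ring
    simp only [hd] at hb
    -- For the difference `d` of two solutions, `d + |d|` is balanced and nonnegative. If it is
    -- positive, then `d > 0` on the cabal, against total mass 0; if it vanishes, then `d ≤ 0`, and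
    -- total mass 0 gives `d = 0`.
    have hdich := (hb.linear_comb hb.abs 1 1).pos_or_eq_zero hFE fun x _ => by
      linarith [neg_abs_le (γ x - γ' x)]
    have hneg : ∀ x ∈ cabal R, γ x - γ' x ≤ 0 := by
      rcases hdich with hp | hz
      · refine absurd hs (hsumpos (fun x => γ x - γ' x) fun x hx => ?_).ne'
        have := hp x hx
        by_contra hle
        rw [abs_of_nonpos (not_lt.1 hle)] at this
        linarith
      · intro x hx
        linarith [hz x hx, abs_nonneg (γ x - γ' x)]
    have hz := (Finset.sum_eq_zero_iff_of_nonpos fun x hx =>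
      mul_nonpos_of_nonpos_of_nonneg (hneg x (Reach.mem_cabalFinset.1 hx)) (G.mass_pos x).le).1 hs
    funext x
    by_cases hx : x ∈ cabal R
    · have := hz x (Reach.mem_cabalFinset.2 hx)
      exact sub_eq_zero.1 ((mul_eq_zero.1 this).resolve_right (G.mass_pos x).ne')
    · rw [h.2.2.1 x hx, h'.2.2.1 x hx]

end WeightedDigraph
end LeftVectors

/-! ### The reduced graph and its degree bounds -/

section ReducedGraph

variable {V : Type*} {F : Set (V × V)} {G : WeightedDigraph V}

namespace WeightedDigraph

theorem rightVec_spec (hFE : F ⊆ G.edgeSet) (hF : F.Finite) (R : Reach F) :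
    G.IsRightKernelVector R (G.rightVec R) :=
  Classical.epsilon_spec (existsUnique_isRightKernelVector hFE hF R).exists

theorem leftVec_spec (hFE : F ⊆ G.edgeSet) (hF : F.Finite) (R : Reach F) :
    G.IsLeftKernelVector R (G.leftVec R) :=
  Classical.epsilon_spec (existsUnique_isLeftKernelVector hFE hF R).exists

section RightVec

variable (hFE : F ⊆ G.edgeSet) (hF : F.Finite)
include hFE hF

theorem rightVec_of_mem_cabal {R : Reach F} {i : V} (hi : i ∈ cabal R) : G.rightVec R i = 1 :=
  (rightVec_spec hFE hF R).2.1 i (R.cabal_subset_exclusivePart hi)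

theorem rightVec_of_notMem {R : Reach F} {i : V} (hi : i ∉ R.1) : G.rightVec R i = 0 :=
  (rightVec_spec hFE hF R).2.2.2 i hi

theorem rightVec_pos {R : Reach F} {i : V} (hi : i ∈ R.1) : 0 < G.rightVec R i := by
  by_cases h : i ∈ commonPart R
  · exact ((rightVec_spec hFE hF R).2.2.1 i h).1
  · rw [(rightVec_spec hFE hF R).2.1 i ⟨hi, fun S hS k hk hp => h ⟨hi, S, hS, k, hk, hp⟩⟩]
    exact one_pos

theorem rightVec_nonneg (R : Reach F) (i : V) : 0 ≤ G.rightVec R i := by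
  by_cases h : i ∈ R.1
  · exact (rightVec_pos hFE hF h).le
  · exact (rightVec_of_notMem hFE hF h).ge

theorem coreLaplacian_rightVec (R : Reach F) (x : V) :
    G.coreLaplacian hF (G.rightVec R) x = 0 :=
  (inLaplacian_restrict_eq_zero hF).1 ((rightVec_spec hFE hF R).1 x)

theorem tsum_rightVec_of_mem_cabal {𝕜 : Type*} [RCLike 𝕜] (c : Reach F → 𝕜) {R : Reach F} {i : V}
    (hi : i ∈ cabal R) : ∑' S : Reach F, c S * (G.rightVec S i : 𝕜) = c R := by
  rw [tsum_eq_single R, rightVec_of_mem_cabal hFE hF hi, RCLike.ofReal_one, mul_one]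
  intro S hS
  rw [rightVec_of_notMem hFE hF fun h => hS (Reach.eq_of_mem_cabal hi h), RCLike.ofReal_zero,
    mul_zero]

theorem tsum_rightVec_eq_sum {𝕜 : Type*} [RCLike 𝕜] (c : Reach F → 𝕜) {v : V}
    {s : Finset (Reach F)} (hs : ∀ R : Reach F, v ∈ R.1 → R ∈ s) :
    ∑' S : Reach F, c S * (G.rightVec S v : 𝕜) = ∑ S ∈ s, c S * (G.rightVec S v : 𝕜) :=
  tsum_eq_sum fun S hS => by
    rw [rightVec_of_notMem hFE hF fun h => hS (hs S h), RCLike.ofReal_zero, mul_zero]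

omit hFE in
theorem exists_finset_reach (T : Finset V) :
    ∃ s : Finset (Reach F), ∀ v ∈ T, ∀ R : Reach F, v ∈ R.1 → R ∈ s := by
  refine ⟨(T.finite_toSet.biUnion fun v _ => Reach.finite_setOf_mem hF v).toFinset,
    fun v hv R hR => ?_⟩
  rw [Set.Finite.mem_toFinset, Set.mem_iUnion₂]
  exact ⟨v, hv, hR⟩

/-- Superpositions of the right kernel vectors are harmonic. -/
theorem coreLaplacian_tsum_rightVec {𝕜 : Type*} [RCLike 𝕜] (c : Reach F → 𝕜) (x : V) :
    G.coreLaplacian hF (fun v => ∑' S : Reach F, c S * (G.rightVec S v : 𝕜)) x = 0 := by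
  classical
  obtain ⟨s, hs⟩ := exists_finset_reach hF (insert x (touched_finite hF).toFinset)
  have h0 : ∀ S : Reach F, ∑ y ∈ (touched_finite hF).toFinset,
      c S * ((G.restrict F).weight x y : 𝕜) * ((G.rightVec S x : 𝕜) - (G.rightVec S y : 𝕜)) = 0 :=
    fun S => by
      have := congrArg (fun t : ℝ => (t : 𝕜)) (coreLaplacian_rightVec hFE hF S x)
      simp only [coreLaplacian, RCLike.ofReal_real_eq_id, id_eq] at this
      push_cast at this
      simp only [mul_assoc, ← Finset.mul_sum]
      rw [this, mul_zero]
  unfold coreLaplacian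
  rw [← Finset.sum_eq_zero (s := s) fun S _ => h0 S, Finset.sum_comm]
  refine Finset.sum_congr rfl fun y hy => ?_
  beta_reduce
  rw [tsum_rightVec_eq_sum hFE hF c (hs x (Finset.mem_insert_self _ _)),
    tsum_rightVec_eq_sum hFE hF c (hs y (Finset.mem_insert_of_mem hy)),
    ← Finset.sum_sub_distrib, Finset.mul_sum]
  exact Finset.sum_congr rfl fun S _ => by ring

/-- The sum is harmonic and equals 1 on every cabal, as does the constant 1. -/
theorem tsum_rightVec (v : V) : ∑' S : Reach F, G.rightVec S v = 1 := by
  have h := coreLaplacian_tsum_rightVec hFE hF (fun _ => (1 : ℝ))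
  have hc : ∀ (R : Reach F), ∀ i ∈ cabal R, _ := fun R i hi =>
    tsum_rightVec_of_mem_cabal hFE hF (fun _ => (1 : ℝ)) hi
  simp only [RCLike.ofReal_real_eq_id, id_eq, one_mul] at h hc
  have := eq_zero_of_harmonic (hF := hF) (x := v) hFE
    (g := (fun v => ∑' S : Reach F, G.rightVec S v) - fun _ => (1 : ℝ))
    (fun w _ => by rw [coreLaplacian_sub, h, coreLaplacian_const, sub_zero])
    (fun R i hi _ => by rw [Pi.sub_apply, hc R i hi, sub_self])
  exact sub_eq_zero.1 this

end RightVec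

section LeftVec

variable (hFE : F ⊆ G.edgeSet) (hF : F.Finite)
include hFE hF

theorem leftVec_of_notMem {R : Reach F} {i : V} (hi : i ∉ cabal R) : G.leftVec R i = 0 :=
  (leftVec_spec hFE hF R).2.2.1 i hi

theorem leftVec_nonneg (R : Reach F) (i : V) : 0 ≤ G.leftVec R i := by
  by_cases h : i ∈ cabal R
  · exact ((leftVec_spec hFE hF R).2.1 i h).le
  · exact (leftVec_of_notMem hFE hF h).ge

theorem sum_leftVec_mul_mass (R : Reach F) :
    ∑ j ∈ R.cabalFinset hF, G.leftVec R j * G.mass j = 1 := by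
  rw [← tsum_mul_mass (leftVec_spec hFE hF R).2.2.1, (leftVec_spec hFE hF R).2.2.2]

theorem pairing_leftVec_eq_sum {𝕜 : Type*} [RCLike 𝕜] (R : Reach F) (f : V → 𝕜) :
    weightedPairing G.mass (fun v => (G.leftVec R v : 𝕜)) f =
      ∑ x ∈ R.cabalFinset hF, ((G.leftVec R x * G.mass x : ℝ) : 𝕜) * f x :=
  weightedPairing_eq_sum (leftVec_spec hFE hF R).2.2.1 f

theorem pairing_leftVec_of_const {𝕜 : Type*} [RCLike 𝕜] {R : Reach F} {f : V → 𝕜} {c : 𝕜}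
    (hf : ∀ i ∈ cabal R, f i = c) :
    weightedPairing G.mass (fun v => (G.leftVec R v : 𝕜)) f = c := by
  rw [pairing_leftVec_eq_sum hFE hF,
    Finset.sum_congr rfl fun x hx => by rw [hf x (Reach.mem_cabalFinset.1 hx)],
    ← Finset.sum_mul, ← RCLike.ofReal_sum, sum_leftVec_mul_mass hFE hF, RCLike.ofReal_one, one_mul]

theorem pairing_leftVec_inLaplacian {𝕜 : Type*} [RCLike 𝕜] (R : Reach F) (f : V → 𝕜) :
    weightedPairing G.mass (fun v => (G.leftVec R v : 𝕜)) ((G.restrict F).inLaplacian f) = 0 :=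
  (isBalanced_of_pairing_eq_zero (hF := hF) (leftVec_spec hFE hF R).2.2.1
    (leftVec_spec hFE hF R).1).pairing_eq_zero (leftVec_spec hFE hF R).2.2.1 f

end LeftVec

section Mass

variable (hFE : F ⊆ G.edgeSet) (hF : F.Finite)
include hFE hF

theorem kernelProj_indicator (R : Reach F) :
    G.kernelProj F (R.1.indicator 1) = G.rightVec R := by
  funext v
  have hp : ∀ (S : Reach F) (c : ℝ), (∀ i ∈ cabal S, R.1.indicator (1 : V → ℝ) i = c) →
      weightedPairing G.mass (G.leftVec S) (R.1.indicator (1 : V → ℝ)) = c := fun S c h => by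
    simpa using pairing_leftVec_of_const hFE hF h
  rw [kernelProj, tsum_eq_single R, hp R 1, mul_one]
  · exact fun i hi => Set.indicator_of_mem hi.1 _
  · intro S hS
    rw [hp S 0, mul_zero]
    exact fun i hi => Set.indicator_of_notMem
      (fun h => hS (Reach.eq_of_mem_cabal hi h).symm) _

theorem reducedMass_eq_tsum (R : Reach F) :
    G.reducedMass F R = ∑' v, G.mass v * G.rightVec R v := by
  rw [reducedMass, kernelProj_indicator hFE hF, weightedPairing]
  refine tsum_congr fun v => ?_
  by_cases hv : v ∈ R.1
  · simp [hv, mul_comm]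
  · simp [rightVec_of_notMem hFE hF hv]

theorem reducedMass_eq_sum (R : Reach F) :
    G.reducedMass F R = ∑ v ∈ (R.finite hF).toFinset, G.mass v * G.rightVec R v := by
  rw [reducedMass_eq_tsum hFE hF]
  refine tsum_eq_sum fun v hv => ?_
  rw [rightVec_of_notMem hFE hF fun h => hv ((Set.Finite.mem_toFinset _).2 h), mul_zero]

theorem reducedMass_pos (R : Reach F) : 0 < G.reducedMass F R := by
  rw [reducedMass_eq_sum hFE hF]
  obtain ⟨i, hi⟩ := R.cabal_nonempty
  exact Finset.sum_pos (fun v hv => mul_pos (G.mass_pos v)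
    (rightVec_pos hFE hF ((Set.Finite.mem_toFinset _).1 hv)))
    ⟨i, (Set.Finite.mem_toFinset _).2 hi.1⟩

/-- This column bound serves `Jdown` and the reduced out-degrees. A vertex lies in at most one
cabal; touched vertices give finitely many values, and an untouched vertex in a cabal forms a reach
by itself, with product exactly 1. -/
theorem exists_reducedMass_mul_leftVec_le :
    ∃ K : ℝ, 0 ≤ K ∧ ∀ v, ∑' R : Reach F, G.reducedMass F R * G.leftVec R v ≤ K := by
  have hfin : ({R : Reach F | ∃ v ∈ touched F, v ∈ R.1} ×ˢ touched F).Finite := by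
    refine Set.Finite.prod ?_ (touched_finite hF)
    refine ((touched_finite hF).biUnion fun v _ => Reach.finite_setOf_mem hF v).subset ?_
    rintro R ⟨v, hv, hR⟩
    exact Set.mem_iUnion₂.2 ⟨v, hv, hR⟩
  obtain ⟨K, hK⟩ := (hfin.image fun p : Reach F × V =>
    G.reducedMass F p.1 * G.leftVec p.1 p.2).bddAbove
  refine ⟨max K 1, le_max_of_le_right zero_le_one, fun v => ?_⟩
  by_cases hv : ∃ R : Reach F, v ∈ cabal R
  · obtain ⟨R, hR⟩ := hv
    rw [tsum_eq_single R]
    · by_cases ht : v ∈ touched F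
      · exact le_max_of_le_left (hK ⟨(R, v), ⟨⟨v, ht, hR.1⟩, ht⟩, rfl⟩)
      · refine le_max_of_le_right (le_of_eq ?_)
        have hc := Reach.cabal_eq_singleton_of_not_touched ht hR.1
        have hRv : ∀ w ∈ R.1, w = v := fun w hw =>
          ((Reach.hasPath_of_mem_cabal hR hw).eq_or_touched.resolve_right fun h => ht h.1).symm
        have h1 : G.reducedMass F R = G.mass v := by
          rw [reducedMass_eq_tsum hFE hF, tsum_eq_single v, rightVec_of_mem_cabal hFE hF hR,
            mul_one]
          exact fun w hw => by rw [rightVec_of_notMem hFE hF fun h => hw (hRv w h), mul_zero]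
        have h2 := (leftVec_spec hFE hF R).2.2.2
        rw [tsum_eq_single v fun w hw => by
          rw [leftVec_of_notMem hFE hF fun h => hw (hRv w h.1), zero_mul]] at h2
        rw [h1, mul_comm, h2]
    · exact fun S hS => by
        rw [leftVec_of_notMem hFE hF fun h => hS (Reach.eq_of_mem_cabal hR h.1), mul_zero]
  · push Not at hv
    refine le_max_of_le_right ?_
    rw [tsum_congr fun R => by rw [leftVec_of_notMem hFE hF (hv R), mul_zero], tsum_zero]
    exact zero_le_one

end Mass

section Weight

variable (hFE : F ⊆ G.edgeSet) (hF : F.Finite)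
include hFE hF

theorem reducedWeight_eq_sum (R S : Reach F) {U Q : Finset V}
    (hU : ∀ r ∉ U, ∀ s, G.leftVec R r * G.weight r s * G.rightVec S s = 0)
    (hQ : ∀ r ∈ U, ∀ s ∉ Q, G.leftVec R r * G.weight r s * G.rightVec S s = 0) :
    G.reducedWeight F R S = G.reducedMass F R *
      ∑ r ∈ U, ∑ s ∈ Q, G.leftVec R r * G.weight r s * G.rightVec S s := by
  have h1 : ∀ r, ∑' s : S.1, G.leftVec R r * G.weight r s * G.rightVec S s =
      ∑' s, G.leftVec R r * G.weight r s * G.rightVec S s := fun r => by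
    refine tsum_subtype_eq_of_support_subset
      (f := fun s => G.leftVec R r * G.weight r s * G.rightVec S s) fun s hs => ?_
    by_contra h
    exact hs (by simp [rightVec_of_notMem hFE hF h])
  have h2 : ∑' r : R.1, ∑' s, G.leftVec R r * G.weight r s * G.rightVec S s =
      ∑' r, ∑' s, G.leftVec R r * G.weight r s * G.rightVec S s := by
    refine tsum_subtype_eq_of_support_subset
      (f := fun r => ∑' s, G.leftVec R r * G.weight r s * G.rightVec S s) fun r hr => ?_
    by_contra h
    exact hr (by simp [leftVec_of_notMem hFE hF fun h' => h h'.1])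
  rw [reducedWeight, tsum_congr fun r : R.1 => h1 r, h2,
    tsum_eq_sum (s := U) fun r hr => by simp [hU r hr],
    Finset.sum_congr rfl fun r hr => tsum_eq_sum (hQ r hr)]

omit hFE in
theorem exists_finset_in (R : Reach F) :
    ∃ T : Finset V, ∀ r ∈ cabal R, ∀ s ∉ T, G.weight r s = 0 := by
  refine ⟨((R.finite_cabal hF).biUnion fun r _ => G.finite_in r).toFinset, fun r hr s hs => ?_⟩
  refine le_antisymm (not_lt.1 fun h => hs ?_) (G.weight_nonneg r s)
  rw [Set.Finite.mem_toFinset, Set.mem_iUnion₂]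
  exact ⟨r, hr, h⟩

omit hFE in
theorem exists_finset_out (S : Reach F) :
    ∃ U : Finset V, ∀ s ∈ S.1, ∀ r ∉ U, G.weight r s = 0 := by
  refine ⟨((S.finite hF).biUnion fun s _ => G.finite_out s).toFinset, fun s hs r hr => ?_⟩
  refine le_antisymm (not_lt.1 fun h => hr ?_) (G.weight_nonneg r s)
  rw [Set.Finite.mem_toFinset, Set.mem_iUnion₂]
  exact ⟨s, hs, h⟩

theorem reducedWeight_eq_sum_in (R S : Reach F) {T : Finset V}
    (hT : ∀ r ∈ cabal R, ∀ s ∉ T, G.weight r s = 0) :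
    G.reducedWeight F R S = G.reducedMass F R *
      ∑ r ∈ R.cabalFinset hF, ∑ s ∈ T, G.leftVec R r * G.weight r s * G.rightVec S s :=
  reducedWeight_eq_sum hFE hF R S
    (fun r hr s => by
      rw [leftVec_of_notMem hFE hF fun h => hr (Reach.mem_cabalFinset.2 h), zero_mul, zero_mul])
    (fun r hr s hs => by rw [hT r (Reach.mem_cabalFinset.1 hr) s hs, mul_zero, zero_mul])

theorem reducedWeight_eq_sum_out (R S : Reach F) {U : Finset V}
    (hU : ∀ s ∈ S.1, ∀ r ∉ U, G.weight r s = 0) :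
    G.reducedWeight F R S = G.reducedMass F R *
      ∑ r ∈ U, ∑ s ∈ (S.finite hF).toFinset, G.leftVec R r * G.weight r s * G.rightVec S s :=
  reducedWeight_eq_sum hFE hF R S
    (fun r hr s => by
      by_cases hs : s ∈ S.1
      · rw [hU s hs r hr, mul_zero, zero_mul]
      · rw [rightVec_of_notMem hFE hF hs, mul_zero])
    (fun r _ s hs => by
      rw [rightVec_of_notMem hFE hF fun h => hs ((Set.Finite.mem_toFinset _).2 h), mul_zero])

theorem reducedWeight_nonneg (R S : Reach F) : 0 ≤ G.reducedWeight F R S :=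
  mul_nonneg (reducedMass_pos hFE hF R).le <| tsum_nonneg fun _ => tsum_nonneg fun _ =>
    mul_nonneg (mul_nonneg (leftVec_nonneg hFE hF _ _) (G.weight_nonneg _ _))
      (rightVec_nonneg hFE hF _ _)

theorem reducedWeight_eq_zero_of_in {R S : Reach F} {T : Finset V}
    (hT : ∀ r ∈ cabal R, ∀ s ∉ T, G.weight r s = 0) (hS : ∀ s ∈ T, s ∉ S.1) :
    G.reducedWeight F R S = 0 := by
  rw [reducedWeight_eq_sum_in hFE hF R S hT, Finset.sum_eq_zero, mul_zero]
  exact fun r _ => Finset.sum_eq_zero fun s hs => by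
    rw [rightVec_of_notMem hFE hF (hS s hs), mul_zero]

theorem reducedWeight_eq_zero_of_out {R S : Reach F} {U : Finset V}
    (hU : ∀ s ∈ S.1, ∀ r ∉ U, G.weight r s = 0) (hR : ∀ r ∈ U, r ∉ R.1) :
    G.reducedWeight F R S = 0 := by
  rw [reducedWeight_eq_sum_out hFE hF R S hU, Finset.sum_eq_zero, mul_zero]
  exact fun r hr => Finset.sum_eq_zero fun s _ => by
    rw [leftVec_of_notMem hFE hF fun h => hR r hr h.1, zero_mul, zero_mul]

/-- The reduced graph. -/
noncomputable def reducedGraph : WeightedDigraph (Reach F) where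
  mass := G.reducedMass F
  weight := G.reducedWeight F
  mass_pos := reducedMass_pos hFE hF
  weight_nonneg := reducedWeight_nonneg hFE hF
  finite_in R := by
    obtain ⟨T, hT⟩ := exists_finset_in (G := G) hF R
    obtain ⟨s, hs⟩ := exists_finset_reach hF T
    refine s.finite_toSet.subset fun S hS => ?_
    by_contra h
    exact (ne_of_gt hS) (reducedWeight_eq_zero_of_in hFE hF hT fun v hv hvS => h (hs v hv S hvS))
  finite_out S := by
    obtain ⟨U, hU⟩ := exists_finset_out (G := G) hF S
    obtain ⟨s, hs⟩ := exists_finset_reach hF U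
    refine s.finite_toSet.subset fun R hR => ?_
    by_contra h
    exact (ne_of_gt hR) (reducedWeight_eq_zero_of_out hFE hF hU fun v hv hvR => h (hs v hv R hvR))

/-- Interchanging sums turns the sum over reaches into the values at `s` of the interpolation of
`c`. -/
theorem tsum_reducedWeight_mul {𝕜 : Type*} [RCLike 𝕜] (R : Reach F) (c : Reach F → 𝕜)
    {T : Finset V} (hT : ∀ r ∈ cabal R, ∀ s ∉ T, G.weight r s = 0) :
    ∑' S : Reach F, (G.reducedWeight F R S : 𝕜) * c S = (G.reducedMass F R : 𝕜) *
      ∑ r ∈ R.cabalFinset hF, ∑ s ∈ T, ((G.leftVec R r * G.weight r s : ℝ) : 𝕜) *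
        ∑' S : Reach F, c S * (G.rightVec S s : 𝕜) := by
  obtain ⟨t, ht⟩ := exists_finset_reach hF T
  rw [tsum_eq_sum (s := t) fun S hS => by
    rw [reducedWeight_eq_zero_of_in hFE hF hT fun v hv hvS => hS (ht v hv S hvS),
      RCLike.ofReal_zero, zero_mul]]
  have h1 : ∀ r ∈ R.cabalFinset hF, ∀ s ∈ T, ((G.leftVec R r * G.weight r s : ℝ) : 𝕜) *
      ∑' S : Reach F, c S * (G.rightVec S s : 𝕜) =
      ∑ S ∈ t, ((G.leftVec R r * G.weight r s * G.rightVec S s : ℝ) : 𝕜) * c S := fun r _ s hs => by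
    rw [tsum_rightVec_eq_sum hFE hF c (ht s hs), Finset.mul_sum]
    refine Finset.sum_congr rfl fun S _ => ?_
    push_cast
    ring
  rw [Finset.sum_congr rfl fun r hr => Finset.sum_congr rfl (h1 r hr),
    Finset.sum_congr rfl fun r _ => Finset.sum_comm, Finset.sum_comm, Finset.mul_sum]
  refine Finset.sum_congr rfl fun S _ => ?_
  rw [reducedWeight_eq_sum_in hFE hF R S hT]
  push_cast
  simp only [mul_assoc, Finset.sum_mul, Finset.mul_sum]

theorem inDegree_reducedGraph (R : Reach F) {T : Finset V}
    (hT : ∀ r ∈ cabal R, ∀ s ∉ T, G.weight r s = 0) :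
    (reducedGraph hFE hF).inDegree R = G.reducedMass F R *
      ∑ r ∈ R.cabalFinset hF, ∑ s ∈ T, G.leftVec R r * G.weight r s := by
  have h := tsum_reducedWeight_mul hFE hF R (fun _ => (1 : ℝ)) hT
  simp only [RCLike.ofReal_real_eq_id, id_eq, one_mul, mul_one, tsum_rightVec hFE hF] at h
  exact h

theorem degreeBounded_reducedGraph (hG : G.DegreeBounded) :
    (reducedGraph hFE hF).DegreeBounded := by
  obtain ⟨C, hC, hd⟩ := hG
  obtain ⟨K, hK0, hK⟩ := exists_reducedMass_mul_leftVec_le hFE hF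
  -- `C` serves the in-degree, since the left vector has total mass 1; `K * C` serves the
  -- out-degree.
  refine ⟨C + K * C, by positivity, fun R => ⟨?_, ?_⟩⟩
  · obtain ⟨T, hT⟩ := exists_finset_in (G := G) hF R
    have hm := reducedMass_pos hFE hF R
    have h1 : ∑ r ∈ R.cabalFinset hF, ∑ s ∈ T, G.leftVec R r * G.weight r s ≤ C := by
      calc _ = ∑ r ∈ R.cabalFinset hF, G.leftVec R r * G.inDegree r :=
            Finset.sum_congr rfl fun r hr => by
              rw [← Finset.mul_sum, inDegree_eq_sum (hT r (Reach.mem_cabalFinset.1 hr))]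
        _ ≤ ∑ r ∈ R.cabalFinset hF, G.leftVec R r * (C * G.mass r) :=
            Finset.sum_le_sum fun r _ =>
              mul_le_mul_of_nonneg_left (hd r).1 (leftVec_nonneg hFE hF R r)
        _ = C * ∑ r ∈ R.cabalFinset hF, G.leftVec R r * G.mass r := by
            rw [Finset.mul_sum]
            exact Finset.sum_congr rfl fun r _ => by ring
        _ = C := by rw [sum_leftVec_mul_mass hFE hF, mul_one]
    rw [inDegree_reducedGraph hFE hF R hT]
    change _ ≤ (C + K * C) * G.reducedMass F R
    have h2 : 0 ≤ K * C := by positivity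
    nlinarith
  · obtain ⟨U, hU⟩ := exists_finset_out (G := G) hF R
    obtain ⟨t, ht⟩ := exists_finset_reach hF U
    have hm := reducedMass_pos hFE hF R
    set Q := (R.finite hF).toFinset with hQ
    have hmemQ : ∀ s ∈ Q, s ∈ R.1 := fun s hs => (Set.Finite.mem_toFinset _).1 hs
    set X : V → ℝ := fun r => ∑ s ∈ Q, G.weight r s * G.rightVec R s with hX
    have hX0 : ∀ r, 0 ≤ X r := fun r => Finset.sum_nonneg fun s _ =>
      mul_nonneg (G.weight_nonneg r s) (rightVec_nonneg hFE hF R s)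
    have hsum : ∀ r, ∑ S ∈ t, G.reducedMass F S * G.leftVec S r ≤ K := fun r => by
      refine le_trans (Summable.sum_le_tsum t (fun S _ => mul_nonneg (reducedMass_pos hFE hF S).le
        (leftVec_nonneg hFE hF S r)) ?_) (hK r)
      refine summable_of_hasFiniteSupport ((Reach.finite_setOf_mem hF r).subset fun S hS => ?_)
      by_contra h
      exact hS (by simp [leftVec_of_notMem hFE hF fun h' => h h'.1])
    have h1 : (reducedGraph hFE hF).outDegree R ≤ K * (C * G.reducedMass F R) := by
      calc (reducedGraph hFE hF).outDegree R = ∑ S ∈ t, G.reducedWeight F S R :=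
            tsum_eq_sum fun S hS => reducedWeight_eq_zero_of_out hFE hF hU
              fun v hv hvS => hS (ht v hv S hvS)
        _ = ∑ r ∈ U, (∑ S ∈ t, G.reducedMass F S * G.leftVec S r) * X r := by
            simp only [Finset.sum_mul]
            rw [Finset.sum_comm]
            refine Finset.sum_congr rfl fun S _ => ?_
            rw [reducedWeight_eq_sum_out hFE hF S R hU]
            simp only [hX, Finset.mul_sum, mul_assoc, hQ]
        _ ≤ ∑ r ∈ U, K * X r := Finset.sum_le_sum fun r _ =>
            mul_le_mul_of_nonneg_right (hsum r) (hX0 r)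
        _ = K * ∑ s ∈ Q, G.outDegree s * G.rightVec R s := by
            rw [← Finset.mul_sum, hX, Finset.sum_comm]
            congr 1
            refine Finset.sum_congr rfl fun s hs => ?_
            rw [← Finset.sum_mul, outDegree, tsum_eq_sum (hU s (hmemQ s hs))]
        _ ≤ K * ∑ s ∈ Q, C * (G.mass s * G.rightVec R s) := by
            refine mul_le_mul_of_nonneg_left (Finset.sum_le_sum fun s _ => ?_) hK0
            rw [← mul_assoc]
            exact mul_le_mul_of_nonneg_right (hd s).2 (rightVec_nonneg hFE hF R s)
        _ = _ := by rw [← Finset.mul_sum, ← reducedMass_eq_sum hFE hF]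
    refine h1.trans ?_
    change _ ≤ (C + K * C) * G.reducedMass F R
    have h2 : 0 ≤ C * G.reducedMass F R := by positivity
    nlinarith

end Weight

end WeightedDigraph
end ReducedGraph

/-! ### Construction of the bounded operators -/

section Operators

variable {V : Type*} {F : Set (V × V)} {G : WeightedDigraph V}

namespace WeightedDigraph

theorem weight_eq_zero_of_not_pos {x y : V} (h : ¬ 0 < G.weight x y) : G.weight x y = 0 :=
  le_antisymm (not_lt.1 h) (G.weight_nonneg x y)

theorem summable_weight_in (x : V) : Summable fun y => G.weight x y :=
  summable_of_hasFiniteSupport ((G.finite_in x).subset fun _ hy =>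
    by_contra fun h => hy (weight_eq_zero_of_not_pos h))

theorem summable_weight_out (y : V) : Summable fun x => G.weight x y :=
  summable_of_hasFiniteSupport ((G.finite_out y).subset fun _ hy =>
    by_contra fun h => hy (weight_eq_zero_of_not_pos h))

theorem DegreeBounded.restrict (hG : G.DegreeBounded) (F : Set (V × V)) :
    (G.restrict F).DegreeBounded := by
  obtain ⟨C, hC, hd⟩ := hG
  have hle : ∀ x y, (G.restrict F).weight x y ≤ G.weight x y := fun x y => by
    by_cases h : (x, y) ∈ F
    · rw [restrict_weight_of_mem h]
    · rw [restrict_weight_of_notMem h]; exact G.weight_nonneg x y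
  exact ⟨C, hC, fun v =>
    ⟨((summable_weight_in v).tsum_le_tsum (hle v) (summable_weight_in v)).trans (hd v).1,
      ((summable_weight_out v).tsum_le_tsum (fun w => hle w v) (summable_weight_out v)).trans
        (hd v).2⟩⟩

theorem exists_isInLaplacian {m : V → ℝ} (hm : G.mass = m) (hG : G.DegreeBounded) :
    ∃ L : WeightedEll2 m →L[ℂ] WeightedEll2 m, G.IsInLaplacian L := by
  classical
  subst hm
  obtain ⟨C, hC, hd⟩ := hG
  have hm := G.mass_pos
  have hin : ∀ x, 0 ≤ G.inDegree x := fun x => tsum_nonneg (G.weight_nonneg x)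
  -- Schur's test needs nonnegative kernels, so the diagonal and the off-diagonal sum are treated
  -- separately and subtracted.
  obtain ⟨T₁, hT₁⟩ := WeightedEll2.exists_schur hm hm
    (K := fun x y => if y = x then (G.mass x)⁻¹ * G.inDegree x else 0) (c₁ := C) (c₂ := C)
    (fun x y => by
      split_ifs
      · exact mul_nonneg (inv_nonneg.2 (hm x).le) (hin x)
      · exact le_rfl)
    (fun x => (Set.finite_singleton x).subset fun y hy => by
      by_contra h
      exact hy (if_neg h))
    (fun y => (Set.finite_singleton y).subset fun x hx => by
      by_contra h
      exact hx (if_neg fun h' => h h'.symm)) hC.le hC.le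
    (fun x => by
      rw [tsum_ite_eq, inv_mul_le_iff₀ (hm x), mul_comm]
      exact (hd x).1)
    (fun y => by
      rw [tsum_eq_single y fun x hx => by rw [if_neg fun h => hx h.symm, mul_zero], if_pos rfl,
        mul_inv_cancel_left₀ (hm y).ne']
      exact (hd y).1)
  obtain ⟨T₂, hT₂⟩ := WeightedEll2.exists_schur hm hm
    (K := fun x y => (G.mass x)⁻¹ * G.weight x y) (c₁ := C) (c₂ := C)
    (fun x y => mul_nonneg (inv_nonneg.2 (hm x).le) (G.weight_nonneg x y))
    (fun x => (G.finite_in x).subset fun y hy => by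
      by_contra h
      exact hy (by simp [weight_eq_zero_of_not_pos h]))
    (fun y => (G.finite_out y).subset fun x hx => by
      by_contra h
      exact hx (by simp [weight_eq_zero_of_not_pos h])) hC.le hC.le
    (fun x => by
      rw [tsum_mul_left, inv_mul_le_iff₀ (hm x), mul_comm]
      exact (hd x).1)
    (fun y => by
      rw [tsum_congr fun x => mul_inv_cancel_left₀ (hm x).ne' _]
      exact (hd y).2)
  refine ⟨T₁ - T₂, rfl, fun f x => ?_⟩
  rw [_root_.sub_apply, WeightedEll2.sub_apply hm, hT₁, hT₂, inLaplacian, mul_sub]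
  congr 1
  · rw [tsum_eq_single x fun y hy => by rw [if_neg hy, Complex.ofReal_zero, zero_mul], if_pos rfl]
    push_cast
    rw [mul_assoc]
    rfl
  · rw [← tsum_mul_left]
    refine tsum_congr fun y => ?_
    push_cast
    rw [mul_assoc]
    rfl

/-- Row sums are 1 by the partition of unity, and the weighted column sums are exactly the reduced
masses. -/
theorem exists_isInterpolationOp (hFE : F ⊆ G.edgeSet) (hF : F.Finite) :
    ∃ J : WeightedEll2 (G.reducedMass F) →L[ℂ] WeightedEll2 G.mass, G.IsInterpolationOp J := by
  obtain ⟨T, hT⟩ := WeightedEll2.exists_schur (reducedMass_pos hFE hF) G.mass_pos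
    (K := fun v R => G.rightVec R v) (c₁ := 1) (c₂ := 1)
    (fun v R => rightVec_nonneg hFE hF R v)
    (fun v => (Reach.finite_setOf_mem hF v).subset fun R hR => by
      by_contra h
      exact hR (rightVec_of_notMem hFE hF h))
    (fun R => (R.finite hF).subset fun v hv => by
      by_contra h
      exact hv (rightVec_of_notMem hFE hF h)) zero_le_one zero_le_one
    (fun v => (tsum_rightVec hFE hF v).le)
    (fun R => by rw [one_mul, reducedMass_eq_tsum hFE hF])
  refine ⟨T, fun f v => ?_⟩
  rw [hT]
  exact tsum_congr fun R => mul_comm _ _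

theorem exists_isProjectionOp (hFE : F ⊆ G.edgeSet) (hF : F.Finite) :
    ∃ J : WeightedEll2 G.mass →L[ℂ] WeightedEll2 (G.reducedMass F), G.IsProjectionOp J := by
  obtain ⟨K, hK0, hK⟩ := exists_reducedMass_mul_leftVec_le (G := G) hFE hF
  obtain ⟨T, hT⟩ := WeightedEll2.exists_schur G.mass_pos (reducedMass_pos (G := G) hFE hF)
    (K := fun R v => G.leftVec R v * G.mass v) (c₁ := 1) (c₂ := K)
    (fun R v => mul_nonneg (leftVec_nonneg hFE hF R v) (G.mass_pos v).le)
    (fun R => (R.finite_cabal hF).subset fun v hv => by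
      by_contra h
      exact hv (by simp [leftVec_of_notMem hFE hF h]))
    (fun v => (Reach.finite_setOf_mem hF v).subset fun R hR => by
      by_contra h
      exact hR (by simp [leftVec_of_notMem hFE hF fun h' => h h'.1])) zero_le_one hK0
    (fun R => (leftVec_spec hFE hF R).2.2.2.le)
    (fun v => by
      simp only [← mul_assoc]
      rw [tsum_mul_right]
      exact mul_le_mul_of_nonneg_right (hK v) (G.mass_pos v).le)
  refine ⟨T, fun f R => ?_⟩
  rw [hT, weightedPairing]
  refine tsum_congr fun v => ?_
  rw [Complex.conj_ofReal]
  push_cast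
  exact mul_right_comm _ _ _

theorem inLaplacian_restrict_diff_add (f : V → ℂ) (x : V) :
    (G.restrict (G.edgeSet \ F)).inLaplacian f x + (G.restrict F).inLaplacian f x =
      G.inLaplacian f x := by
  set T := (G.finite_in x).toFinset with hT
  have h0 : ∀ y ∉ T, G.weight x y = 0 := fun y hy =>
    weight_eq_zero_of_not_pos fun h => hy ((Set.Finite.mem_toFinset _).2 h)
  have hr : ∀ (F' : Set (V × V)), ∀ y ∉ T, (G.restrict F').weight x y = 0 := fun F' y hy => by
    by_cases h : (x, y) ∈ F'
    · rw [restrict_weight_of_mem h, h0 y hy]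
    · rw [restrict_weight_of_notMem h]
  rw [inLaplacian_eq_sum (hr _), inLaplacian_eq_sum (hr _), inLaplacian_eq_sum h0]
  change (G.mass x : ℂ)⁻¹ * _ + (G.mass x : ℂ)⁻¹ * _ = _
  rw [← mul_add, ← Finset.sum_add_distrib]
  congr 1
  refine Finset.sum_congr rfl fun y hy => ?_
  have hE : (x, y) ∈ G.edgeSet := (G.finite_in x).mem_toFinset.1 hy
  by_cases h : (x, y) ∈ F
  · rw [restrict_weight_of_notMem fun h' => h'.2 h, restrict_weight_of_mem h]
    simp
  · rw [restrict_weight_of_notMem h, restrict_weight_of_mem (F := G.edgeSet \ F) ⟨hE, h⟩]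
    simp

/-- The Laplacian of `F` kills the range of `Ju`, so `LA` may be replaced there by the full
Laplacian. Averaging over the cabal of `R`, where `Ju f` is constantly `f R`, produces the reduced
weights. -/
theorem isInLaplacian_reducedGraph (hFE : F ⊆ G.edgeSet) (hF : F.Finite)
    {LA : WeightedEll2 G.mass →L[ℂ] WeightedEll2 G.mass}
    {Jd : WeightedEll2 G.mass →L[ℂ] WeightedEll2 (G.reducedMass F)}
    {Ju : WeightedEll2 (G.reducedMass F) →L[ℂ] WeightedEll2 G.mass}
    (hLA : (G.restrict (G.edgeSet \ F)).IsInLaplacian LA) (hJd : G.IsProjectionOp Jd)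
    (hJu : G.IsInterpolationOp Ju) :
    (reducedGraph hFE hF).IsInLaplacian (Jd ∘L LA ∘L Ju) := by
  refine ⟨rfl, fun f R => ?_⟩
  obtain ⟨T, hT⟩ := exists_finset_in (G := G) hF R
  have hu : (fun v => Ju f v) = fun v => ∑' S : Reach F, f S * (G.rightVec S v : ℂ) :=
    funext (hJu f)
  have hA : ∀ r ∈ R.cabalFinset hF, LA (Ju f) r = (G.mass r : ℂ)⁻¹ *
      ∑ s ∈ T, (G.weight r s : ℂ) * (f R - ∑' S : Reach F, f S * (G.rightVec S s : ℂ)) := by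
    intro r hr
    have hr' := Reach.mem_cabalFinset.1 hr
    have h1 := inLaplacian_restrict_diff_add (G := G) (F := F) (fun v => Ju f v) r
    have h2 : (G.restrict F).inLaplacian (fun v => Ju f v) r = 0 := by
      rw [hu, inLaplacian_restrict_eq_zero hF]
      exact coreLaplacian_tsum_rightVec hFE hF (fun S => f S) r
    rw [h2, add_zero, inLaplacian_eq_sum (hT r hr')] at h1
    rw [hLA.2, h1]
    simp only [hJu f]
    have h3 := tsum_rightVec_of_mem_cabal (G := G) hFE hF (fun S => f S) hr'
    simp only [RCLike.ofReal_eq_complex_ofReal] at h3 ⊢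
    rw [h3]
  have hm : ((G.reducedMass F R : ℝ) : ℂ) ≠ 0 := by
    exact_mod_cast (reducedMass_pos hFE hF R).ne'
  have hw := tsum_reducedWeight_mul (𝕜 := ℂ) hFE hF R (fun S => f S) hT
  change Jd (LA (Ju f)) R = ((G.reducedMass F R : ℝ) : ℂ)⁻¹ *
    (((reducedGraph hFE hF).inDegree R : ℂ) * f R -
      ∑' S : Reach F, ((G.reducedWeight F R S : ℝ) : ℂ) * f S)
  simp only [RCLike.ofReal_eq_complex_ofReal] at hw
  rw [hw, inDegree_reducedGraph hFE hF R hT, hJd]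
  have hp := pairing_leftVec_eq_sum (G := G) (𝕜 := ℂ) hFE hF R (fun v => LA (Ju f) v)
  simp only [RCLike.ofReal_eq_complex_ofReal] at hp
  rw [hp]
  push_cast
  rw [mul_assoc, ← mul_sub, inv_mul_cancel_left₀ hm, Finset.sum_mul, ← Finset.sum_sub_distrib]
  refine Finset.sum_congr rfl fun r hr => ?_
  have hmr : (G.mass r : ℂ) ≠ 0 := by exact_mod_cast (G.mass_pos r).ne'
  rw [hA r hr, mul_assoc, mul_inv_cancel_left₀ hmr, Finset.mul_sum, Finset.sum_mul,
    ← Finset.sum_sub_distrib]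
  exact Finset.sum_congr rfl fun s _ => by ring

end WeightedDigraph

/-- The functions in `ℓ²(V, m)` that vanish off `N`. -/
noncomputable def WeightedEll2.supportedOn {m : V → ℝ} (hm : ∀ v, 0 < m v) (N : Set V) :
    Submodule ℂ (WeightedEll2 m) where
  carrier := {f | ∀ v ∉ N, f v = 0}
  add_mem' hf hg v hv := by rw [WeightedEll2.add_apply hm, hf v hv, hg v hv, add_zero]
  zero_mem' v _ := WeightedEll2.zero_apply hm v
  smul_mem' c f hf v hv := by rw [WeightedEll2.smul_apply hm, hf v hv, mul_zero]

theorem WeightedEll2.finiteDimensional_supportedOn {m : V → ℝ} (hm : ∀ v, 0 < m v) {N : Set V}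
    (hN : N.Finite) : FiniteDimensional ℂ (WeightedEll2.supportedOn hm N) :=
  WeightedDigraph.finiteDimensional_of_support
    { toFun := fun (f : WeightedEll2 m) v => f v
      map_add' := fun f g => funext fun v => WeightedEll2.add_apply hm f g v
      map_smul' := fun c f => funext fun v => WeightedEll2.smul_apply hm c f v }
    (fun _ _ h => WeightedEll2.ext fun v => congrFun h v) hN _ fun _ hf v hv => hf v hv

end Operators

/-! ### Assembly -/

theorem mainTheorem3 {V : Type*} [Countable V] (G : WeightedDigraph V) (hG : G.DegreeBounded)
    (F : Set (V × V)) (hFE : F ⊆ G.edgeSet) (hF : F.Finite) :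
    (∀ R : Reach F, ∃! γ : V → ℝ, G.IsRightKernelVector R γ) ∧
    (∀ R : Reach F, ∃! γ : V → ℝ, G.IsLeftKernelVector R γ) ∧
    ∃ Gr : WeightedDigraph (Reach F), G.IsReducedGraph F Gr ∧ Gr.DegreeBounded ∧
    ∃ (LA LB : WeightedEll2 G.mass →L[ℂ] WeightedEll2 G.mass)
      (Lr : WeightedEll2 Gr.mass →L[ℂ] WeightedEll2 Gr.mass)
      (Jdown : WeightedEll2 G.mass →L[ℂ] WeightedEll2 Gr.mass)
      (Jup : WeightedEll2 Gr.mass →L[ℂ] WeightedEll2 G.mass),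
      (G.restrict (G.edgeSet \ F)).IsInLaplacian LA ∧
      (G.restrict F).IsInLaplacian LB ∧
      Gr.IsInLaplacian Lr ∧
      G.IsProjectionOp Jdown ∧
      G.IsInterpolationOp Jup ∧
      ∀ z ∈ resolventSet ℂ Lr, ∃ C β₀ : ℝ, 0 < C ∧ 0 < β₀ ∧ ∀ β : ℝ, β₀ ≤ β →
        z ∈ resolventSet ℂ (LA + (β : ℂ) • LB) ∧
        ‖resolventOp (LA + (β : ℂ) • LB) z - Jup ∘L resolventOp Lr z ∘L Jdown‖ ≤ C / β := by

  refine ⟨fun R => WeightedDigraph.existsUnique_isRightKernelVector hFE hF R,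
    fun R => WeightedDigraph.existsUnique_isLeftKernelVector hFE hF R,
    WeightedDigraph.reducedGraph hFE hF, ⟨fun _ => rfl, fun _ _ => rfl⟩,
    WeightedDigraph.degreeBounded_reducedGraph hFE hF hG, ?_⟩
  obtain ⟨LA, hLA⟩ := WeightedDigraph.exists_isInLaplacian (m := G.mass)
    (G := G.restrict (G.edgeSet \ F)) rfl (hG.restrict _)
  obtain ⟨LB, hLB⟩ := WeightedDigraph.exists_isInLaplacian (m := G.mass)
    (G := G.restrict F) rfl (hG.restrict _)
  obtain ⟨Jd, hJd⟩ := WeightedDigraph.exists_isProjectionOp (G := G) hFE hF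
  obtain ⟨Ju, hJu⟩ := WeightedDigraph.exists_isInterpolationOp (G := G) hFE hF
  have hm := G.mass_pos
  have hmr := WeightedDigraph.reducedMass_pos (G := G) hFE hF
  have hup : ∀ (g : WeightedEll2 (G.reducedMass F)) (R : Reach F), ∀ i ∈ cabal R,
      Ju g i = g R := fun g R i hi => by
    rw [hJu]
    exact WeightedDigraph.tsum_rightVec_of_mem_cabal hFE hF (fun S => g S) hi
  have hdown : ∀ (f : WeightedEll2 G.mass) (R : Reach F) (c : ℂ), (∀ i ∈ cabal R, f i = c) →
      Jd f R = c := fun f R c h => by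
    rw [hJd]
    exact WeightedDigraph.pairing_leftVec_of_const hFE hF h
  have hfd := WeightedEll2.finiteDimensional_supportedOn hm (touched_finite hF)
  refine ⟨LA, LB, Jd ∘L LA ∘L Ju, Jd, Ju, hLA, hLB,
    WeightedDigraph.isInLaplacian_reducedGraph hFE hF hLA hJd hJu, hJd, hJu, fun z hz =>
    resolventOp_add_smul_sub_le LA LB Jd Ju (fun g => ?_) (fun g => ?_) (fun f => ?_)
      (fun f hBf hJf => ?_) (WeightedEll2.supportedOn hm (touched F)) (fun f v hv => ?_)
      (fun f v hv => ?_) z hz⟩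
  · exact WeightedEll2.ext fun R => hdown _ R _ fun i hi => hup g R i hi
  · refine WeightedEll2.ext fun x => ?_
    rw [hLB.2, WeightedEll2.zero_apply hm, WeightedDigraph.inLaplacian_restrict_eq_zero hF,
      show (fun v => Ju g v) = _ from funext (hJu g)]
    exact WeightedDigraph.coreLaplacian_tsum_rightVec hFE hF (fun S => g S) x
  · refine WeightedEll2.ext fun R => ?_
    rw [hJd, WeightedEll2.zero_apply hmr, show (fun v => LB f v) = _ from funext (hLB.2 f)]
    exact WeightedDigraph.pairing_leftVec_inLaplacian hFE hF R _
  -- A harmonic `f` is constant on each cabal; the constant is the average `Jd f`, hence 0, so `f`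
  -- vanishes on the boundary and therefore everywhere.
  · have hharm : ∀ x, G.coreLaplacian hF (fun v => f v) x = 0 := fun x => by
      rw [← WeightedDigraph.inLaplacian_restrict_eq_zero hF, ← hLB.2, hBf,
        WeightedEll2.zero_apply hm]
    refine WeightedEll2.ext fun x => ?_
    rw [WeightedEll2.zero_apply hm]
    refine WeightedDigraph.eq_zero_of_harmonic (hF := hF) (g := fun v => f v) hFE
      (fun v _ => hharm v) fun R i hi _ => ?_
    rw [← hdown f R (f i) fun j hj => WeightedDigraph.eq_of_harmonic_of_mem_cabal (hF := hF)
      (g := fun v => f v) hFE (fun v _ => hharm v) hi hj, hJf, WeightedEll2.zero_apply hmr]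
  · rw [hLB.2, WeightedDigraph.inLaplacian_restrict_eq_zero hF]
    exact WeightedDigraph.coreLaplacian_eq_zero_of_not_touched hv _
  -- An untouched vertex is the whole cabal of its reach, so averaging and interpolating return the
  -- value there.
  · obtain ⟨R, hR⟩ := Reach.exists_mem hF v
    have hc := Reach.cabal_eq_singleton_of_not_touched hv hR
    rw [WeightedEll2.sub_apply hm, hup _ R v (hc ▸ rfl), hdown f R (f v), sub_self]
    rw [hc]
    rintro i rfl
    rfl
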